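/- Let $k$ be an algebraically closed field of characteristic $p>0$, let $0<d<n$, and let $G\cong\mathbb G_m^d$ be a subtorus of $T=\mathbb G_m^n$ acting on $X=\mathbb A^n$ through the coordinatewise scaling action of $T$. Let $\chi_1,\dots,\chi_n\in X^*(G)$ be the restrictions to $G$ of the coordinate characters of $T$. Assume that $\pi:X_*(T)\to X_*(T/G)$ is unimodular: any linearly independent set of vectors $\pi(e_j)$ is part of a $\mathbb Z$-basis of $X_*(T/G)$. *The number $N$.* For $\delta\in X^*(G)$ put $$P_\delta=\Big\{v\in\mathbb R_{\ge0}^{2n}:\ \sum_{j=1}^n (v_j-v_{n+j})\chi_j=\delta\Big\},$$ and let $N(\delta)$ be the largest absolute value of a coordinate of a vertex of $P_\delta$. For $I\subseteq\{1,\dots,n\}$ let $T_I\subseteq T$ be the subtorus of points whose $j$-th coordinate is $1$ for all $j\in I$; if $X_*(G)\cap X_*(T_I)$ has rank $1$, let $W_I=\{a\in X^*(G):\langle a,\,X_*(G)\cap X_*(T_I)\rangle=0\}$. Let $N$ be the minimum of $N(\delta)$ over all $\delta\in X^*(G)$ that lie in none of these walls $W_I$ and in no $\mathrm{Span}_{\mathbb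 Z}\{\chi_j\}_{j\in I}$ with $|I|<d$. *Smooth parameters.* Let $\mu:T^*X\to\mathfrak g^*$, $(x,\xi)\mapsto\sum_j x_j\xi_j\,d\chi_j$, be the moment map. Call $\delta\in X^*(G)$ a smooth parameter if $G$ acts freely on the $\delta$-semistable locus $\mu^{-1}(0)^{\delta\text{-}ss}$. *The relation $\le$.* Let $D=k\langle x_1,\dots,x_n,\partial_1,\dots,\partial_n\rangle$ be the Weyl algebra (the crystalline differential operators on $X$), on which $G$ acts with $x_j$ of weight $\chi_j$ and $\partial_j$ of weight $\chi_j^{-1}$, and let $\mu^*(\theta)=\sum_j d\chi_j(\theta)\,x_j\partial_j\in D$ for $\theta\in\mathfrak g$. For $\Lambda_1,\Lambda_2\in X^*(G)$ and $\lambda_i=d\Lambda_i$ let $$B^{\Lambda_1,\Lambda_2}=\big(D/\{\mu^*(\theta)-\lambda_1(\theta)\}_{\theta\in\mathfrak g}D\big)^{\Lambda_1\Lambda_2^{-1}}$$ be the space of $G$-semi-invariants of weight $\Lambda_1\Lambda_2^{-1}$, and let $U_{\lambda_1}=B^{\Lambda_1,\Lambda_1}$. Multiplication in $D$ makes $U_{\lambda_i}$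 an algebra and $B^{\Lambda_1,\Lambda_2}$ a $(U_{\lambda_1},U_{\lambda_2})$-bimodule. Write $\Lambda_1\le\Lambda_2$ if the multiplication map $B^{\Lambda_1,\Lambda_2}\otimes_{U_{\lambda_2}}B^{\Lambda_2,\Lambda_1}\to U_{\lambda_1}$ is surjective. **Proposition.** If $$p>\binom{n}{d-1}(2N)^{\,n-d+1},$$ then there exist a smooth parameter $\delta\in X^*(G)$ and a character $\Lambda\in X^*(G)$ such that $\Lambda\le\Lambda\delta$. -/

import Mathlib

/-!
Conventions. The torus `T = 𝔾ₘⁿ` acts on affine space `X = 𝔸ⁿ` by scaling the coordinates, and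
`G ⊆ T` is a subtorus of dimension `d`, written as `𝔾ₘᵈ` (so that `X^*(G) = X_*(G) = ℤᵈ` with the
standard pairing).  The inclusion is recorded by the weights `χ : Fin n → Fin d → ℤ`, where `χ j` is
the restriction to `G` of the `j`-th coordinate character of `T`; a point `t` of `G` is sent to the
point `(t ^ χ 1, …, t ^ χ n)` of `T`.  This map is a closed embedding iff the `χ j` span `ℤᵈ`.
Characters of `G` are written additively: `Λδ` is `Λ + δ`.
-/

namespace Hypertoric

/-! ### Characters -/

/-- The value `t ^ a` of the character `a ∈ X^*(G) = ℤᵈ` at a point `t` of `G = 𝔾ₘᵈ`. -/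
def chr {R : Type*} [CommRing R] {d : ℕ} (a : Fin d → ℤ) (t : Fin d → Rˣ) : Rˣ :=
  ∏ i, t i ^ a i

theorem chr_zero {R : Type*} [CommRing R] {d : ℕ} (t : Fin d → Rˣ) :
    chr (0 : Fin d → ℤ) t = 1 := by
  simp [chr]

theorem chr_add {R : Type*} [CommRing R] {d : ℕ} (a b : Fin d → ℤ) (t : Fin d → Rˣ) :
    chr (a + b) t = chr a t * chr b t := by
  simp [chr, zpow_add, Finset.prod_mul_distrib]

theorem chr_neg {R : Type*} [CommRing R] {d : ℕ} (a : Fin d → ℤ) (t : Fin d → Rˣ) :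
    chr (-a) t = (chr a t)⁻¹ := by
  simp [chr]

/-- The differential `da ∈ 𝔤^*` of the character `a`, evaluated at `θ ∈ 𝔤 = kᵈ`. -/
def dchr {k : Type*} [Field k] {d : ℕ} (a : Fin d → ℤ) (θ : Fin d → k) : k :=
  ∑ i, (a i : k) * θ i

theorem dchr_zero {k : Type*} [Field k] {d : ℕ} (θ : Fin d → k) :
    dchr (0 : Fin d → ℤ) θ = 0 := by
  simp [dchr]

theorem dchr_add {k : Type*} [Field k] {d : ℕ} (a b : Fin d → ℤ) (θ : Fin d → k) :
    dchr (a + b) θ = dchr a θ + dchr b θ := by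
  simp [dchr, add_mul, Finset.sum_add_distrib]

theorem dchr_neg {k : Type*} [Field k] {d : ℕ} (a : Fin d → ℤ) (θ : Fin d → k) :
    dchr (-a) θ = -dchr a θ := by
  simp [dchr]

theorem dchr_sub {k : Type*} [Field k] {d : ℕ} (a b : Fin d → ℤ) (θ : Fin d → k) :
    dchr (a - b) θ = dchr a θ - dchr b θ := by
  rw [sub_eq_add_neg, dchr_add, dchr_neg, sub_eq_add_neg]

theorem chr_injective (k : Type*) [Field k] [Infinite k] (d : ℕ) :
    Function.Injective
      (fun (a : Fin d → ℤ) (t : Fin d → kˣ) => ((chr a t : kˣ) : k)) := by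
  intro a b hab
  by_contra hne
  obtain ⟨i, hi⟩ := Function.ne_iff.mp hne
  have key : ∀ u : kˣ, u ^ (a i - b i) = 1 := by
    intro u
    have h := congrFun hab (Pi.mulSingle i u)
    have h' : chr a (Pi.mulSingle i u) = chr b (Pi.mulSingle i u) := Units.ext h
    have hc : ∀ c : Fin d → ℤ, chr c (Pi.mulSingle i u) = u ^ c i := by
      intro c
      unfold chr
      rw [Finset.prod_eq_single i]
      · simp
      · intro j _ hj
        simp [Pi.mulSingle_eq_of_ne hj]
      · simp
    rw [hc, hc] at h'
    rw [zpow_sub, h', mul_inv_cancel]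
  have hpos : 0 < (a i - b i).natAbs := Int.natAbs_pos.mpr (sub_ne_zero.mpr hi)
  have key' : ∀ u : kˣ, u ^ (a i - b i).natAbs = 1 := by
    intro u
    rcases Int.natAbs_eq (a i - b i) with h | h
    · have := key u
      rw [h] at this
      simpa using this
    · have := key u
      rw [h, zpow_neg, inv_eq_one] at this
      simpa using this
  classical
  obtain ⟨x, hx⟩ := Infinite.exists_notMem_finset
    (insert (0 : k) (Polynomial.nthRoots (a i - b i).natAbs (1 : k)).toFinset)
  have hx0 : x ≠ 0 := by
    rintro rfl
    exact hx (Finset.mem_insert_self _ _)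
  apply hx
  refine Finset.mem_insert_of_mem ?_
  rw [Multiset.mem_toFinset, Polynomial.mem_nthRoots hpos]
  have := congrArg (fun u : kˣ => (u : k)) (key' (Units.mk0 x hx0))
  simpa using this

/-! ### Differential operators on affine space -/

/-- The relations of the Weyl algebra; `Sum.inl j` stands for `x_j`, `Sum.inr j` for `∂_j`. -/
inductive WeylRel (k : Type*) [Field k] (n : ℕ) :
    FreeAlgebra k (Fin n ⊕ Fin n) → FreeAlgebra k (Fin n ⊕ Fin n) → Prop
  | xx (i j : Fin n) : WeylRel k n
      (FreeAlgebra.ι k (Sum.inl i) * FreeAlgebra.ι k (Sum.inl j))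
      (FreeAlgebra.ι k (Sum.inl j) * FreeAlgebra.ι k (Sum.inl i))
  | dd (i j : Fin n) : WeylRel k n
      (FreeAlgebra.ι k (Sum.inr i) * FreeAlgebra.ι k (Sum.inr j))
      (FreeAlgebra.ι k (Sum.inr j) * FreeAlgebra.ι k (Sum.inr i))
  | dx (i j : Fin n) : WeylRel k n
      (FreeAlgebra.ι k (Sum.inr i) * FreeAlgebra.ι k (Sum.inl j))
      (FreeAlgebra.ι k (Sum.inl j) * FreeAlgebra.ι k (Sum.inr i) + if i = j then 1 else 0)

/-- The algebra `𝒟_X(X)` of crystalline differential operators on `X = 𝔸ⁿ`, that is the Weyl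
algebra `k⟨x₁, …, xₙ, ∂₁, …, ∂ₙ⟩`. -/
def Weyl (k : Type*) [Field k] (n : ℕ) : Type _ := RingQuot (WeylRel k n)

instance (k : Type*) [Field k] (n : ℕ) : Ring (Weyl k n) :=
  inferInstanceAs (Ring (RingQuot (WeylRel k n)))

instance (k : Type*) [Field k] (n : ℕ) : Algebra k (Weyl k n) :=
  inferInstanceAs (Algebra k (RingQuot (WeylRel k n)))

/-- The presentation of the Weyl algebra, as a quotient map from the free algebra. -/
def weylMk (k : Type*) [Field k] (n : ℕ) : FreeAlgebra k (Fin n ⊕ Fin n) →ₐ[k] Weyl k n :=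
  RingQuot.mkAlgHom k (WeylRel k n)

theorem weylMk_surjective (k : Type*) [Field k] (n : ℕ) : Function.Surjective (weylMk k n) :=
  RingQuot.mkAlgHom_surjective k (WeylRel k n)

theorem weylMk_rel (k : Type*) [Field k] {n : ℕ} {a b : FreeAlgebra k (Fin n ⊕ Fin n)}
    (h : WeylRel k n a b) : weylMk k n a = weylMk k n b :=
  RingQuot.mkAlgHom_rel k h

/-- The universal property of the presentation. -/
def weylLift {k : Type*} [Field k] {n : ℕ} {A : Type*} [Semiring A] [Algebra k A]
    (f : FreeAlgebra k (Fin n ⊕ Fin n) →ₐ[k] A) (h : ∀ ⦃a b⦄, WeylRel k n a b → f a = f b) :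
    Weyl k n →ₐ[k] A :=
  RingQuot.liftAlgHom k ⟨f, h⟩

theorem weylLift_mk {k : Type*} [Field k] {n : ℕ} {A : Type*} [Semiring A] [Algebra k A]
    (f : FreeAlgebra k (Fin n ⊕ Fin n) →ₐ[k] A) (h : ∀ ⦃a b⦄, WeylRel k n a b → f a = f b)
    (a : FreeAlgebra k (Fin n ⊕ Fin n)) : weylLift f h (weylMk k n a) = f a :=
  RingQuot.liftAlgHom_mkAlgHom_apply k f h a

/-- The generators: `gen (Sum.inl j) = x_j` and `gen (Sum.inr j) = ∂_j`. -/
def gen (k : Type*) [Field k] {n : ℕ} (c : Fin n ⊕ Fin n) : Weyl k n :=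
  weylMk k n (FreeAlgebra.ι k c)

theorem gen_xx (k : Type*) [Field k] {n : ℕ} (i j : Fin n) :
    gen k (Sum.inl i) * gen k (Sum.inl j) = gen k (Sum.inl j) * gen k (Sum.inl i) := by
  simpa [gen] using weylMk_rel k (WeylRel.xx (k := k) i j)

theorem gen_dd (k : Type*) [Field k] {n : ℕ} (i j : Fin n) :
    gen k (Sum.inr i) * gen k (Sum.inr j) = gen k (Sum.inr j) * gen k (Sum.inr i) := by
  simpa [gen] using weylMk_rel k (WeylRel.dd (k := k) i j)

theorem gen_dx (k : Type*) [Field k] {n : ℕ} (i j : Fin n) :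
    gen k (Sum.inr i) * gen k (Sum.inl j)
      = gen k (Sum.inl j) * gen k (Sum.inr i) + if i = j then 1 else 0 := by
  have := weylMk_rel k (WeylRel.dx (k := k) i j)
  split_ifs at this ⊢ <;> simpa [gen] using this

/-- A submodule of the Weyl algebra that contains `1` and is stable under right multiplication by
the generators is everything. -/
theorem weyl_induction {k : Type*} [Field k] {n : ℕ} (S : Submodule k (Weyl k n))
    (one : (1 : Weyl k n) ∈ S) (mul : ∀ P ∈ S, ∀ c, P * gen k c ∈ S) : S = ⊤ := by
  have h : ∀ a : FreeAlgebra k (Fin n ⊕ Fin n), ∀ P ∈ S,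
      P * weylMk k n a ∈ S := by
    intro a
    induction a using FreeAlgebra.induction with
    | grade0 r =>
      intro P hP
      rw [AlgHom.commutes, ← Algebra.commutes, ← Algebra.smul_def]
      exact S.smul_mem r hP
    | grade1 c => exact fun P hP => mul P hP c
    | mul a b ha hb =>
      intro P hP
      rw [map_mul, ← mul_assoc]
      exact hb _ (ha _ hP)
    | add a b ha hb =>
      intro P hP
      rw [map_add, mul_add]
      exact S.add_mem (ha _ hP) (hb _ hP)
  rw [eq_top_iff]
  intro P _
  obtain ⟨a, rfl⟩ := weylMk_surjective k n P
  simpa using h a 1 one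

/-- The weight of a generator: `x_j` has weight `χ j` and `∂_j` has weight `-χ j`. -/
def weight {n d : ℕ} (χ : Fin n → Fin d → ℤ) : Fin n ⊕ Fin n → Fin d → ℤ :=
  Sum.elim χ (fun j => -χ j)

/-- The action of `G` on `𝒟_X(X)` by algebra automorphisms: `t • x_j = t ^ χ j • x_j` and
`t • ∂_j = t ^ (-χ j) • ∂_j`. -/
def act {k : Type*} [Field k] {n d : ℕ} (χ : Fin n → Fin d → ℤ) (t : Fin d → kˣ) :
    Weyl k n →ₐ[k] Weyl k n :=
  weylLift (FreeAlgebra.lift k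
    (fun c => ((chr (weight χ c) t : kˣ) : k) • gen k c)) (by
      intro a b h
      induction h with
      | xx i j => simp [gen_xx k i j, mul_comm (chr (weight χ (Sum.inl i)) t : k), smul_smul]
      | dd i j => simp [gen_dd k i j, mul_comm (chr (weight χ (Sum.inr i)) t : k), smul_smul]
      | dx i j =>
        simp only [map_mul, FreeAlgebra.lift_ι_apply, smul_mul_smul_comm, gen_dx k i j, map_add,
          smul_add]
        rw [mul_comm (chr (weight χ (Sum.inl j)) t : k)]
        congr 1
        split_ifs with hij
        · subst hij
          simp [weight, chr_neg]
        · simp)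

theorem act_gen {k : Type*} [Field k] {n d : ℕ} (χ : Fin n → Fin d → ℤ) (t : Fin d → kˣ)
    (c : Fin n ⊕ Fin n) : act χ t (gen k c) = ((chr (weight χ c) t : kˣ) : k) • gen k c := by
  simp [act, gen, weylLift_mk]

/-- The quantum comoment map `μ^* : 𝔤 → 𝒟_X(X)`, `θ ↦ ∑_j dχ_j(θ) x_j ∂_j`, the differential of
the action of `G` on functions. -/
def comoment {k : Type*} [Field k] {n d : ℕ} (χ : Fin n → Fin d → ℤ) (θ : Fin d → k) : Weyl k n :=
  ∑ j, dchr (χ j) θ • (gen k (Sum.inl j) * gen k (Sum.inr j))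

theorem act_comoment {k : Type*} [Field k] {n d : ℕ} (χ : Fin n → Fin d → ℤ) (t : Fin d → kˣ)
    (θ : Fin d → k) : act χ t (comoment χ θ) = comoment χ θ := by
  simp [comoment, act_gen, weight, chr_neg]

theorem comoment_gen {k : Type*} [Field k] {n d : ℕ} (χ : Fin n → Fin d → ℤ) (θ : Fin d → k)
    (c : Fin n ⊕ Fin n) :
    comoment χ θ * gen k c - gen k c * comoment χ θ = dchr (weight χ c) θ • gen k c := by
  have hx : ∀ i j : Fin n, gen k (Sum.inl j) * gen k (Sum.inr j) * gen k (Sum.inl i)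
      - gen k (Sum.inl i) * (gen k (Sum.inl j) * gen k (Sum.inr j))
      = if j = i then gen k (Sum.inl i) else 0 := by
    intro i j
    rw [mul_assoc, gen_dx, ← mul_assoc (gen k (Sum.inl i)), gen_xx k i j, mul_add, ← mul_assoc,
      add_sub_cancel_left]
    split_ifs with h
    · rw [h, mul_one]
    · simp
  have hd : ∀ i j : Fin n, gen k (Sum.inl j) * gen k (Sum.inr j) * gen k (Sum.inr i)
      - gen k (Sum.inr i) * (gen k (Sum.inl j) * gen k (Sum.inr j))
      = if j = i then -gen k (Sum.inr i) else 0 := by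
    intro i j
    rw [← mul_assoc (gen k (Sum.inr i)), gen_dx, mul_assoc, gen_dd k j i, add_mul, ← mul_assoc]
    by_cases h : i = j
    · simp [h]
    · simp [h, Ne.symm h]
  unfold comoment
  rw [Finset.sum_mul, Finset.mul_sum, ← Finset.sum_sub_distrib]
  rcases c with i | i
  · simp only [smul_mul_assoc, mul_smul_comm, ← smul_sub, hx]
    simp [weight]
  · simp only [smul_mul_assoc, mul_smul_comm, ← smul_sub, hd]
    simp [weight, dchr_neg]

/-- Operators of weight `a`, both for `G` and for its Lie algebra. -/
def weightSpace {n d : ℕ} (k : Type*) [Field k] (χ : Fin n → Fin d → ℤ) (a : Fin d → ℤ) :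
    Submodule k (Weyl k n) where
  carrier := {P | (∀ t, act χ t P = ((chr a t : kˣ) : k) • P) ∧
    ∀ θ, comoment χ θ * P - P * comoment χ θ = dchr a θ • P}
  zero_mem' := by simp
  add_mem' := by
    rintro P Q ⟨hP, hP'⟩ ⟨hQ, hQ'⟩
    refine ⟨fun t => by rw [map_add, hP, hQ, smul_add], fun θ => ?_⟩
    rw [smul_add, ← hP', ← hQ']
    noncomm_ring
  smul_mem' := by
    rintro r P ⟨hP, hP'⟩
    refine ⟨fun t => by rw [map_smul, hP, smul_comm], fun θ => ?_⟩
    rw [smul_comm, ← hP', smul_sub, mul_smul_comm, smul_mul_assoc]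

theorem weightSpace_mul_gen {k : Type*} [Field k] {n d : ℕ} (χ : Fin n → Fin d → ℤ)
    {a : Fin d → ℤ} {P : Weyl k n} (hP : P ∈ weightSpace k χ a) (c : Fin n ⊕ Fin n) :
    P * gen k c ∈ weightSpace k χ (a + weight χ c) := by
  refine ⟨fun t => ?_, fun θ => ?_⟩
  · rw [map_mul, hP.1, act_gen, smul_mul_smul_comm, chr_add, Units.val_mul]
  · have h1 := hP.2 θ
    have h2 := comoment_gen χ θ c
    rw [dchr_add, add_smul, ← smul_mul_assoc, ← h1, ← mul_smul_comm (dchr (weight χ c) θ), ← h2]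
    simp only [mul_sub, sub_mul, mul_assoc]
    abel

theorem iSup_weightSpace {k : Type*} [Field k] {n d : ℕ} (χ : Fin n → Fin d → ℤ) :
    ⨆ a, weightSpace k χ a = ⊤ := by
  apply weyl_induction
  · refine Submodule.mem_iSup_of_mem 0 ⟨fun t => by simp [chr_zero], fun θ => by simp [dchr_zero]⟩
  · intro P hP c
    let L : Weyl k n →ₗ[k] Weyl k n := LinearMap.mulRight k (gen k c)
    have hle : ⨆ a, weightSpace k χ a ≤ (⨆ a, weightSpace k χ a).comap L := by
      refine iSup_le fun a Q hQ => ?_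
      exact Submodule.mem_iSup_of_mem _ (weightSpace_mul_gen χ hQ c)
    exact hle hP

/-! ### Transfer bimodules -/

/-- The right ideal `{μ^*(θ) - λ(θ)}_{θ ∈ 𝔤} 𝒟_X(X)` for `λ = dΛ`. -/
def rightIdeal (k : Type*) [Field k] {n d : ℕ} (χ : Fin n → Fin d → ℤ) (Λ : Fin d → ℤ) :
    Submodule k (Weyl k n) :=
  Submodule.span k
    {Q | ∃ θ P, Q = (comoment χ θ - algebraMap k (Weyl k n) (dchr Λ θ)) * P}

theorem rightIdeal_mul_mem {k : Type*} [Field k] {n d : ℕ} (χ : Fin n → Fin d → ℤ)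
    {Λ : Fin d → ℤ} {P : Weyl k n} (hP : P ∈ rightIdeal k χ Λ) (Q : Weyl k n) :
    P * Q ∈ rightIdeal k χ Λ := by
  have hle : rightIdeal k χ Λ ≤ (rightIdeal k χ Λ).comap (LinearMap.mulRight k Q) := by
    refine Submodule.span_le.mpr ?_
    rintro _ ⟨θ, R, rfl⟩
    exact Submodule.subset_span ⟨θ, R * Q, by simp [mul_assoc]⟩
  exact hle hP

theorem rightIdeal_act {k : Type*} [Field k] {n d : ℕ} (χ : Fin n → Fin d → ℤ)
    (Λ : Fin d → ℤ) (t : Fin d → kˣ) :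
    rightIdeal k χ Λ ≤ (rightIdeal k χ Λ).comap (act χ t).toLinearMap := by
  refine Submodule.span_le.mpr ?_
  rintro _ ⟨θ, R, rfl⟩
  exact Submodule.subset_span ⟨θ, act χ t R, by simp [act_comoment]⟩

/-- The quotient `𝒟_X(X) / {μ^*(θ) - λ(θ)}_{θ ∈ 𝔤} 𝒟_X(X)` for `λ = dΛ`. -/
def DQuot (k : Type*) [Field k] {n d : ℕ} (χ : Fin n → Fin d → ℤ) (Λ : Fin d → ℤ) : Type _ :=
  Weyl k n ⧸ rightIdeal k χ Λ

instance (k : Type*) [Field k] {n d : ℕ} (χ : Fin n → Fin d → ℤ) (Λ : Fin d → ℤ) :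
    AddCommGroup (DQuot k χ Λ) :=
  inferInstanceAs (AddCommGroup (Weyl k n ⧸ rightIdeal k χ Λ))

instance (k : Type*) [Field k] {n d : ℕ} (χ : Fin n → Fin d → ℤ) (Λ : Fin d → ℤ) :
    Module k (DQuot k χ Λ) :=
  inferInstanceAs (Module k (Weyl k n ⧸ rightIdeal k χ Λ))

/-- The class of an operator in the quotient. -/
def cls {k : Type*} [Field k] {n d : ℕ} (χ : Fin n → Fin d → ℤ) (Λ : Fin d → ℤ) :
    Weyl k n →ₗ[k] DQuot k χ Λ :=
  (rightIdeal k χ Λ).mkQ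

theorem cls_surjective {k : Type*} [Field k] {n d : ℕ} (χ : Fin n → Fin d → ℤ) (Λ : Fin d → ℤ) :
    Function.Surjective (cls (k := k) χ Λ) :=
  (rightIdeal k χ Λ).mkQ_surjective

theorem cls_eq_zero {k : Type*} [Field k] {n d : ℕ} (χ : Fin n → Fin d → ℤ) (Λ : Fin d → ℤ)
    {P : Weyl k n} : cls χ Λ P = 0 ↔ P ∈ rightIdeal k χ Λ :=
  Submodule.Quotient.mk_eq_zero _

/-- Linear maps out of the quotient. -/
def clsLift {k : Type*} [Field k] {n d : ℕ} (χ : Fin n → Fin d → ℤ) (Λ : Fin d → ℤ)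
    {M : Type*} [AddCommGroup M] [Module k M] (f : Weyl k n →ₗ[k] M)
    (h : ∀ P ∈ rightIdeal k χ Λ, f P = 0) : DQuot k χ Λ →ₗ[k] M :=
  (rightIdeal k χ Λ).liftQ f h

theorem clsLift_cls {k : Type*} [Field k] {n d : ℕ} (χ : Fin n → Fin d → ℤ) (Λ : Fin d → ℤ)
    {M : Type*} [AddCommGroup M] [Module k M] (f : Weyl k n →ₗ[k] M)
    (h : ∀ P ∈ rightIdeal k χ Λ, f P = 0) (P : Weyl k n) :
    clsLift χ Λ f h (cls χ Λ P) = f P :=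
  rfl

/-- The induced action of `G` on the quotient. -/
def actQuot {k : Type*} [Field k] {n d : ℕ} (χ : Fin n → Fin d → ℤ) (Λ : Fin d → ℤ)
    (t : Fin d → kˣ) : DQuot k χ Λ →ₗ[k] DQuot k χ Λ :=
  clsLift χ Λ ((cls χ Λ).comp (act χ t).toLinearMap)
    (fun _ hP => (cls_eq_zero χ Λ).mpr (rightIdeal_act χ Λ t hP))

theorem actQuot_cls {k : Type*} [Field k] {n d : ℕ} (χ : Fin n → Fin d → ℤ) (Λ : Fin d → ℤ)
    (t : Fin d → kˣ) (P : Weyl k n) : actQuot χ Λ t (cls χ Λ P) = cls χ Λ (act χ t P) :=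
  rfl

/-- The semi-invariants of weight `a` in the quotient `DQuot k χ Λ`. -/
def semiInv (k : Type*) [Field k] {n d : ℕ} (χ : Fin n → Fin d → ℤ) (Λ a : Fin d → ℤ) :
    Submodule k (DQuot k χ Λ) where
  carrier := {v | ∀ t : Fin d → kˣ, actQuot χ Λ t v = ((chr a t : kˣ) : k) • v}
  zero_mem' := by simp
  add_mem' := by
    intro v w hv hw t
    rw [map_add, hv, hw, smul_add]
  smul_mem' := by
    intro r v hv t
    rw [map_smul, hv, smul_comm]

/-- The transfer bimodule `B^{Λ₁, Λ₂}`: the semi-invariants of weight `Λ₁Λ₂⁻¹` in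
`𝒟_X(X) / {μ^*(θ) - λ₁(θ)}_{θ ∈ 𝔤} 𝒟_X(X)`, where `λ₁ = dΛ₁`. -/
abbrev B (k : Type*) [Field k] {n d : ℕ} (χ : Fin n → Fin d → ℤ) (Λ₁ Λ₂ : Fin d → ℤ) :
    Submodule k (DQuot k χ Λ₁) :=
  semiInv k χ Λ₁ (Λ₁ - Λ₂)

/-- The hypertoric enveloping algebra `U_λ = (𝒟_X(X) / {μ^*(θ) - λ(θ)} 𝒟_X(X))^G`, `λ = dΛ`
(as a vector space; its multiplication is `mulB χ Λ Λ Λ`). -/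
abbrev U (k : Type*) [Field k] {n d : ℕ} (χ : Fin n → Fin d → ℤ) (Λ : Fin d → ℤ) :
    Submodule k (DQuot k χ Λ) :=
  B k χ Λ Λ

theorem iSupIndep_semiInv (k : Type*) [Field k] [Infinite k] {n d : ℕ} (χ : Fin n → Fin d → ℤ)
    (Λ : Fin d → ℤ) : iSupIndep (semiInv k χ Λ) := by
  have hact : ∀ s t : Fin d → kˣ, Commute (actQuot (k := k) χ Λ s) (actQuot (k := k) χ Λ t) := by
    intro s t
    have h : ∀ P : Weyl k n, act χ s (act χ t P) = act χ t (act χ s P) := by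
      intro P
      have hP : P ∈ ⨆ a, weightSpace k χ a := by
        rw [iSup_weightSpace]
        trivial
      induction hP using Submodule.iSup_induction' with
      | mem a Q hQ => simp [hQ.1, smul_comm ((chr a s : kˣ) : k)]
      | zero => simp
      | add Q R _ _ hQ hR => simp [hQ, hR]
    refine LinearMap.ext fun v => ?_
    obtain ⟨P, rfl⟩ := cls_surjective χ Λ v
    simp [actQuot_cls, h]
  have key := Module.End.independent_iInf_maxGenEigenspace_of_forall_mapsTo
    (fun t : Fin d → kˣ => actQuot (k := k) χ Λ t)
    (fun s t φ => Module.End.mapsTo_maxGenEigenspace_of_comm (hact t s) φ)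
  refine (key.comp (chr_injective k d)).mono fun a v hv => ?_
  refine (Submodule.mem_iInf _).mpr fun t => ?_
  have h1 : v ∈ Module.End.eigenspace (actQuot (k := k) χ Λ t) ((chr a t : kˣ) : k) :=
    Module.End.mem_eigenspace_iff.mpr (hv t)
  exact Module.End.genEigenspace_le_maximal _ _ 1 h1

/-- Semi-invariants of the quotient lift to operators of the same weight. -/
theorem semiInv_lift {k : Type*} [Field k] [Infinite k] {n d : ℕ} (χ : Fin n → Fin d → ℤ)
    {Λ a : Fin d → ℤ} {v : DQuot k χ Λ} (hv : v ∈ semiInv k χ Λ a) :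
    ∃ P ∈ weightSpace k χ a, (cls χ Λ) P = v := by
  have hmap : ∀ b, (weightSpace k χ b) ≤ (semiInv k χ Λ b).comap (cls χ Λ) := by
    intro b P hP t
    have := congrArg (cls χ Λ) (hP.1 t)
    simpa [actQuot_cls] using this
  obtain ⟨P, rfl⟩ := cls_surjective χ Λ v
  have hP : P ∈ weightSpace k χ a ⊔ ⨆ b, ⨆ (_ : b ≠ a), weightSpace k χ b := by
    have hle : ⨆ b, weightSpace k χ b
        ≤ weightSpace k χ a ⊔ ⨆ b, ⨆ (_ : b ≠ a), weightSpace k χ b := by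
      refine iSup_le fun b => ?_
      by_cases hb : b = a
      · subst hb
        exact le_sup_left
      · exact le_sup_of_le_right (le_iSup₂_of_le b hb le_rfl)
    apply hle
    rw [iSup_weightSpace]
    trivial
  obtain ⟨Q, hQ, R, hR, rfl⟩ := Submodule.mem_sup.mp hP
  refine ⟨Q, hQ, ?_⟩
  have hR' : (cls χ Λ) R ∈ ⨆ b, ⨆ (_ : b ≠ a), semiInv k χ Λ b := by
    have hle : ⨆ b, ⨆ (_ : b ≠ a), weightSpace k χ b
        ≤ (⨆ b, ⨆ (_ : b ≠ a), semiInv k χ Λ b).comap (cls χ Λ) :=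
      iSup₂_le fun b hb => (hmap b).trans
        (Submodule.comap_mono (le_iSup₂_of_le b hb le_rfl))
    exact hle hR
  have hR'' : (cls χ Λ) R ∈ semiInv k χ Λ a := by
    have h := (semiInv k χ Λ a).sub_mem hv (hmap a hQ)
    rwa [map_add, add_sub_cancel_left] at h
  have h0 := Submodule.disjoint_def.mp (iSupIndep_semiInv k χ Λ a) _ hR'' hR'
  rw [map_add, h0, add_zero]

/-- The right action of operators on the quotient, `(P̄, Q) ↦ class of P Q`. -/
def rmul {k : Type*} [Field k] {n d : ℕ} (χ : Fin n → Fin d → ℤ) (Λ : Fin d → ℤ) :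
    DQuot k χ Λ →ₗ[k] Weyl k n →ₗ[k] DQuot k χ Λ :=
  clsLift χ Λ ((LinearMap.mul k (Weyl k n)).compr₂ (cls χ Λ)) (by
    intro P hP
    refine LinearMap.ext fun Q => ?_
    simpa using (cls_eq_zero χ Λ).mpr (rightIdeal_mul_mem χ hP Q))

theorem rmul_mk {k : Type*} [Field k] {n d : ℕ} (χ : Fin n → Fin d → ℤ) (Λ : Fin d → ℤ)
    (P Q : Weyl k n) :
    rmul χ Λ ((cls χ Λ) P) Q = (cls χ Λ) (P * Q) := rfl

theorem mul_mem_rightIdeal {k : Type*} [Field k] {n d : ℕ} (χ : Fin n → Fin d → ℤ)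
    {Λ₁ Λ₂ : Fin d → ℤ} {P : Weyl k n} (hP : P ∈ weightSpace k χ (Λ₁ - Λ₂)) {Q : Weyl k n}
    (hQ : Q ∈ rightIdeal k χ Λ₂) : P * Q ∈ rightIdeal k χ Λ₁ := by
  have hle : rightIdeal k χ Λ₂ ≤ (rightIdeal k χ Λ₁).comap (LinearMap.mulLeft k P) := by
    refine Submodule.span_le.mpr ?_
    rintro _ ⟨θ, R, rfl⟩
    refine Submodule.subset_span ⟨θ, P * R, ?_⟩
    have h := hP.2 θ
    have h' : P * comoment χ θ = comoment χ θ * P - dchr (Λ₁ - Λ₂) θ • P := by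
      rw [← h]
      abel
    rw [LinearMap.mulLeft_apply, ← mul_assoc, mul_sub, h', dchr_sub, ← mul_assoc, sub_mul,
      ← Algebra.commutes, ← Algebra.smul_def, sub_mul, sub_mul, ← Algebra.smul_def, sub_smul]
    simp only [sub_mul]
    abel
  exact hle hQ

theorem rmul_eq_zero {k : Type*} [Field k] [Infinite k] {n d : ℕ} (χ : Fin n → Fin d → ℤ)
    {Λ₁ Λ₂ : Fin d → ℤ} {v : DQuot k χ Λ₁} (hv : v ∈ B k χ Λ₁ Λ₂) {Q : Weyl k n}
    (hQ : Q ∈ rightIdeal k χ Λ₂) : rmul χ Λ₁ v Q = 0 := by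
  obtain ⟨P, hP, rfl⟩ := semiInv_lift χ hv
  rw [rmul_mk]
  exact (cls_eq_zero χ Λ₁).mpr (mul_mem_rightIdeal χ hP hQ)

/-- Left multiplication by `v ∈ B^{Λ₁, Λ₂}`, `Q̄ ↦ v Q̄`, well defined on the quotient at `λ₂`. -/
def lmul {k : Type*} [Field k] [Infinite k] {n d : ℕ} (χ : Fin n → Fin d → ℤ)
    (Λ₁ Λ₂ : Fin d → ℤ) (v : B k χ Λ₁ Λ₂) : DQuot k χ Λ₂ →ₗ[k] DQuot k χ Λ₁ :=
  clsLift χ Λ₂ (rmul χ Λ₁ v) (fun _ hQ => rmul_eq_zero χ v.2 hQ)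

theorem lmul_mk {k : Type*} [Field k] [Infinite k] {n d : ℕ} (χ : Fin n → Fin d → ℤ)
    (Λ₁ Λ₂ : Fin d → ℤ) (v : B k χ Λ₁ Λ₂) (P Q : Weyl k n)
    (hP : (cls χ Λ₁) P = v) :
    lmul χ Λ₁ Λ₂ v ((cls χ Λ₂) Q) = (cls χ Λ₁) (P * Q) := by
  rw [← rmul_mk, hP]
  rfl

theorem lmul_mem {k : Type*} [Field k] [Infinite k] {n d : ℕ} (χ : Fin n → Fin d → ℤ)
    (Λ₁ Λ₂ Λ₃ : Fin d → ℤ) (v : B k χ Λ₁ Λ₂) (w : B k χ Λ₂ Λ₃) :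
    lmul χ Λ₁ Λ₂ v w ∈ B k χ Λ₁ Λ₃ := by
  obtain ⟨P, hP, hPv⟩ := semiInv_lift χ v.2
  obtain ⟨Q, hQ, hQw⟩ := semiInv_lift χ w.2
  rw [← hQw, lmul_mk χ Λ₁ Λ₂ v P Q hPv]
  intro t
  have h : act χ t (P * Q) = ((chr (Λ₁ - Λ₃) t : kˣ) : k) • (P * Q) := by
    rw [map_mul, hP.1, hQ.1, smul_mul_smul_comm, ← Units.val_mul, ← chr_add, sub_add_sub_cancel]
  have := congrArg (cls χ Λ₁) h
  simpa [actQuot_cls] using this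

/-- The multiplication `B^{Λ₁, Λ₂} × B^{Λ₂, Λ₃} → B^{Λ₁, Λ₃}`, `(P̄, Q̄) ↦ class of P Q`. It includes
the product of `U_λ` and the left and right actions of the algebras `U_λ` on the bimodules. -/
def mulB {k : Type*} [Field k] [Infinite k] {n d : ℕ} (χ : Fin n → Fin d → ℤ)
    (Λ₁ Λ₂ Λ₃ : Fin d → ℤ) : B k χ Λ₁ Λ₂ →ₗ[k] B k χ Λ₂ Λ₃ →ₗ[k] B k χ Λ₁ Λ₃ :=
  LinearMap.mk₂ k (fun v w => ⟨lmul χ Λ₁ Λ₂ v w, lmul_mem χ Λ₁ Λ₂ Λ₃ v w⟩)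
    (by
      intro v v' w
      obtain ⟨Q, hQ⟩ := cls_surjective χ Λ₂ w.1
      refine Subtype.ext ?_
      simp only [← hQ, Submodule.coe_add, lmul, clsLift_cls, map_add,
        LinearMap.add_apply])
    (by
      intro r v w
      obtain ⟨Q, hQ⟩ := cls_surjective χ Λ₂ w.1
      refine Subtype.ext ?_
      simp only [← hQ, Submodule.coe_smul, lmul, clsLift_cls,
        map_smul, LinearMap.smul_apply])
    (by
      intro v w w'
      refine Subtype.ext ?_
      simp)
    (by
      intro r v w
      refine Subtype.ext ?_
      simp)

theorem mulB_coe {k : Type*} [Field k] [Infinite k] {n d : ℕ} (χ : Fin n → Fin d → ℤ)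
    (Λ₁ Λ₂ Λ₃ : Fin d → ℤ) (v : B k χ Λ₁ Λ₂) (w : B k χ Λ₂ Λ₃) (P Q : Weyl k n)
    (hP : (cls χ Λ₁) P = v) (hQ : (cls χ Λ₂) Q = w) :
    (mulB χ Λ₁ Λ₂ Λ₃ v w : DQuot k χ Λ₁) = (cls χ Λ₁) (P * Q) := by
  rw [← lmul_mk χ Λ₁ Λ₂ v P Q hP, hQ]
  rfl

theorem mulB_assoc {k : Type*} [Field k] [Infinite k] {n d : ℕ} (χ : Fin n → Fin d → ℤ)
    (Λ₁ Λ₂ Λ₃ Λ₄ : Fin d → ℤ) (u : B k χ Λ₁ Λ₂) (v : B k χ Λ₂ Λ₃) (w : B k χ Λ₃ Λ₄) :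
    mulB χ Λ₁ Λ₃ Λ₄ (mulB χ Λ₁ Λ₂ Λ₃ u v) w = mulB χ Λ₁ Λ₂ Λ₄ u (mulB χ Λ₂ Λ₃ Λ₄ v w) := by
  obtain ⟨P, hP⟩ := cls_surjective χ Λ₁ u.1
  obtain ⟨Q, hQ⟩ := cls_surjective χ Λ₂ v.1
  obtain ⟨R, hR⟩ := cls_surjective χ Λ₃ w.1
  refine Subtype.ext ?_
  rw [mulB_coe χ Λ₁ Λ₃ Λ₄ _ w (P * Q) R (mulB_coe χ Λ₁ Λ₂ Λ₃ u v P Q hP hQ).symm hR,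
    mulB_coe χ Λ₁ Λ₂ Λ₄ u _ P (Q * R) hP (mulB_coe χ Λ₂ Λ₃ Λ₄ v w Q R hQ hR).symm, mul_assoc]

open scoped TensorProduct in
/-- The relations `b u ⊗ b' - b ⊗ u b'`, `u ∈ U_{λ₂}`, of the tensor product over `U_{λ₂}`. -/
def balanced (k : Type*) [Field k] [Infinite k] {n d : ℕ} (χ : Fin n → Fin d → ℤ)
    (Λ₁ Λ₂ : Fin d → ℤ) : Submodule k (B k χ Λ₁ Λ₂ ⊗[k] B k χ Λ₂ Λ₁) :=
  Submodule.span k {z | ∃ (b : B k χ Λ₁ Λ₂) (u : U k χ Λ₂) (b' : B k χ Λ₂ Λ₁),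
    z = mulB χ Λ₁ Λ₂ Λ₂ b u ⊗ₜ[k] b' - b ⊗ₜ[k] mulB χ Λ₂ Λ₂ Λ₁ u b'}

open scoped TensorProduct in
/-- The tensor product `B^{Λ₁, Λ₂} ⊗_{U_{λ₂}} B^{Λ₂, Λ₁}` over the noncommutative algebra `U_{λ₂}`. -/
abbrev BTensor (k : Type*) [Field k] [Infinite k] {n d : ℕ} (χ : Fin n → Fin d → ℤ)
    (Λ₁ Λ₂ : Fin d → ℤ) : Type _ :=
  (B k χ Λ₁ Λ₂ ⊗[k] B k χ Λ₂ Λ₁) ⧸ balanced k χ Λ₁ Λ₂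

/-- The multiplication map `B^{Λ₁, Λ₂} ⊗_{U_{λ₂}} B^{Λ₂, Λ₁} → U_{λ₁}`. -/
def transferMap (k : Type*) [Field k] [Infinite k] {n d : ℕ} (χ : Fin n → Fin d → ℤ)
    (Λ₁ Λ₂ : Fin d → ℤ) : BTensor k χ Λ₁ Λ₂ →ₗ[k] U k χ Λ₁ :=
  (balanced k χ Λ₁ Λ₂).liftQ (TensorProduct.lift (mulB χ Λ₁ Λ₂ Λ₁)) (by
    refine Submodule.span_le.mpr ?_
    rintro _ ⟨b, u, b', rfl⟩
    simp [mulB_assoc])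

/-- The surjection relation `Λ₁ ≤ Λ₂`. -/
def TransferLE (k : Type*) [Field k] [Infinite k] {n d : ℕ} (χ : Fin n → Fin d → ℤ)
    (Λ₁ Λ₂ : Fin d → ℤ) : Prop :=
  Function.Surjective (transferMap k χ Λ₁ Λ₂)

/-! ### Smooth parameters -/

/-- The action of `R`-points of `G` on `R`-points of `T^*X = 𝔸²ⁿ`; `Sum.inl j` indexes the
coordinate `x_j`, and `Sum.inr j` the dual coordinate `ξ_j`. -/
def actPoint {R : Type*} [CommRing R] {n d : ℕ} (χ : Fin n → Fin d → ℤ) (t : Fin d → Rˣ)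
    (y : Fin n ⊕ Fin n → R) : Fin n ⊕ Fin n → R :=
  fun c => ((chr (weight χ c) t : Rˣ) : R) * y c

/-- `R`-points of the scheme `μ⁻¹(0)`, the zero fibre of the moment map `μ : T^*X → 𝔤^*`,
`(x, ξ) ↦ ∑_j x_j ξ_j dχ_j`. -/
def zeroFibre (R : Type*) [CommRing R] {n d : ℕ} (χ : Fin n → Fin d → ℤ) :
    Set (Fin n ⊕ Fin n → R) :=
  {y | ∀ i, ∑ j, (χ j i : R) * (y (Sum.inl j) * y (Sum.inr j)) = 0}

/-- The semi-invariant functions on `T^*X` of weight `a`, `𝒪(T^*X)^a`. -/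
def semiInvFun (k : Type*) [Field k] {n d : ℕ} (χ : Fin n → Fin d → ℤ) (a : Fin d → ℤ) :
    Set (MvPolynomial (Fin n ⊕ Fin n) k) :=
  {s | ∀ t : Fin d → kˣ,
    MvPolynomial.aeval
      (fun c => MvPolynomial.C ((chr (weight χ c) t : kˣ) : k) * MvPolynomial.X c) s
      = MvPolynomial.C ((chr a t : kˣ) : k) * s}

/-- `R`-points of the open subscheme `(T^*X)^{δ-ss}` of `T^*X`, the union of the loci where some
semi-invariant function `s` of weight `δ^m`, `m > 0`, is invertible.  (As the torus `G` is linearly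
reductive, semi-invariant functions on `μ⁻¹(0)` extend to `T^*X`, so that `μ⁻¹(0)^{δ-ss}` is
`μ⁻¹(0) ∩ (T^*X)^{δ-ss}`.) -/
def semistable (k : Type*) [Field k] (R : Type*) [CommRing R] [Algebra k R] {n d : ℕ}
    (χ : Fin n → Fin d → ℤ) (δ : Fin d → ℤ) : Set (Fin n ⊕ Fin n → R) :=
  {y | Ideal.span {r : R | ∃ m : ℕ, 0 < m ∧ ∃ s ∈ semiInvFun k χ (m • δ),
    r = MvPolynomial.aeval y s} = ⊤}

/-- `δ` is a smooth parameter: the group scheme `G` acts freely on `μ⁻¹(0)^{δ-ss}`, that is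
`G(R)` acts freely on the `R`-points for every commutative `k`-algebra `R`. -/
def IsSmoothParameter.{u} (k : Type u) [Field k] {n d : ℕ} (χ : Fin n → Fin d → ℤ)
    (δ : Fin d → ℤ) : Prop :=
  ∀ (R : Type u) [CommRing R] [Algebra k R] (y : Fin n ⊕ Fin n → R),
    y ∈ zeroFibre R χ → y ∈ semistable k R χ δ →
      ∀ t : Fin d → Rˣ, actPoint χ t y = y → t = 1

/-! ### The combinatorics of the torus and the number `N` -/

/-- The map `X_*(G) → X_*(T)` induced by `G ⊆ T`. -/
def cocharMap {n d : ℕ} (χ : Fin n → Fin d → ℤ) : (Fin d → ℤ) →ₗ[ℤ] (Fin n → ℤ) :=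
  Matrix.mulVecLin (Matrix.of χ)

/-- The map `π : X_*(T) → X_*(T/G) = X_*(T)/X_*(G)` is unimodular: any linearly independent set of
its columns `π(e_j)` is part of a `ℤ`-basis of the codomain. -/
def IsUnimodular {n d : ℕ} (χ : Fin n → Fin d → ℤ) : Prop :=
  ∀ S : Set (Fin n),
    LinearIndepOn ℤ
      (fun j => (LinearMap.range (cocharMap χ)).mkQ (Pi.single j 1)) S →
    ∃ (ι : Type) (b : Module.Basis ι ℤ ((Fin n → ℤ) ⧸ LinearMap.range (cocharMap χ))),
      ∀ j ∈ S, (LinearMap.range (cocharMap χ)).mkQ (Pi.single j 1) ∈ Set.range b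

/-- The lattice `X_*(G) ∩ X_*(T_I)`, as a sublattice of `X_*(G) = ℤᵈ`; here `T_I ⊆ T` consists
of the points whose `j`-th coordinate is `1` for all `j ∈ I`. -/
def subCochar {n d : ℕ} (χ : Fin n → Fin d → ℤ) (I : Finset (Fin n)) :
    Submodule ℤ (Fin d → ℤ) where
  carrier := {b | ∀ j ∈ I, cocharMap χ b j = 0}
  zero_mem' := by simp
  add_mem' := by
    intro b c hb hc j hj
    simp [hb j hj, hc j hj]
  smul_mem' := by
    intro r b hb j hj
    rw [map_smul, Pi.smul_apply, hb j hj, smul_zero]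

/-- The wall `W_I ⊆ X^*(G)`. -/
def wall {n d : ℕ} (χ : Fin n → Fin d → ℤ) (I : Finset (Fin n)) : Set (Fin d → ℤ) :=
  {a | ∀ b ∈ subCochar χ I, a ⬝ᵥ b = 0}

/-- `δ` lies in no wall `W_I` with `rank (X_*(G) ∩ X_*(T_I)) = 1`, and in no
`Span_ℤ {χ_j}_{j ∈ I}` with `|I| < dim 𝔤`. -/
def IsGeneric {n d : ℕ} (χ : Fin n → Fin d → ℤ) (δ : Fin d → ℤ) : Prop :=
  (∀ I : Finset (Fin n), Module.finrank ℤ (subCochar χ I) = 1 → δ ∉ wall χ I) ∧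
  ∀ I : Finset (Fin n), I.card < d → δ ∉ Submodule.span ℤ (χ '' (I : Set (Fin n)))

/-- The polyhedron `P_δ`, of all `v ≥ 0` in `X^*(𝔾ₘ²ⁿ)_ℝ = ℝ²ⁿ` whose restriction
`∑_j (v_j - v_{n+j}) χ_j` to `G` is `δ`. -/
def polyhedron {n d : ℕ} (χ : Fin n → Fin d → ℤ) (δ : Fin d → ℤ) : Set (Fin n ⊕ Fin n → ℝ) :=
  {v | (∀ i, ∑ j, (v (Sum.inl j) - v (Sum.inr j)) * (χ j i : ℝ) = (δ i : ℝ)) ∧ ∀ c, 0 ≤ v c}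

/-- `N(δ)`, the largest absolute value of a coordinate of a vertex of `P_δ`. -/
noncomputable def vertexBound {n d : ℕ} (χ : Fin n → Fin d → ℤ) (δ : Fin d → ℤ) : ℝ :=
  sSup {r | ∃ v ∈ Set.extremePoints ℝ (polyhedron χ δ), ∃ c, r = |v c|}

/-- `N`, the smallest `N(δ)` for generic `δ`. -/
noncomputable def minBound {n d : ℕ} (χ : Fin n → Fin d → ℤ) : ℝ :=
  sInf {r | ∃ δ, IsGeneric χ δ ∧ r = vertexBound χ δ}

end Hypertoric

namespace Hypertoric

/-! ### Bases among the weights -/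

/-! Both conclusions come from expanding a generic character `δ` in bases of weights. By Gale
duality, unimodularity says that any `d` weights with nonzero determinant form a `ℤ`-basis of
`X^*(G)` (`isUnit_det_of_ne_zero`). So `δ` has integral coordinates in each such basis, and they are
bounded by `N(δ)`, because their positive and negative parts form a vertex of `P_δ`
(`exists_bounded_coordinates`).

Smoothness. If a monomial has weight `mδ` with `m > 0`, the weights of its variables contain a
basis, since otherwise `δ` would lie in the integral span of `d - 1` weights. A point of `G` that
fixes `y` therefore acts trivially on the value of the monomial at `y`. On the semistable locus
these values generate the unit ideal, so the point of `G` is `1`.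

Surjectivity. If `∑ a_j χ_j = δ`, multiplying a suitable monomial of weight `-δ` by one of weight
`δ` gives a product of linear polynomials in the Euler operators `x_j ∂_j`. Modulo the moment map
relations these polynomials are functions on the affine space of `z` with `∑ z_j dχ_j = dΛ`. By the
Nullstellensatz, `Λ ≤ Λδ` follows if at each such `z` one of these products is nonzero
(`transferLE_of_forall_exists`).

Let `M = ⌊N(δ)⌋` and call `z_j` small if it is the residue of an integer in `[-M, M)`; all roots of
the factors with `|a_j| ≤ M` are small. If the weights with `z_j` not small contain a basis, the
expansion of `δ` in it works at `z`. Otherwise they lie in a hyperplane spanned by `d - 1` weights,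
indexed by `I`. A functional that kills this hyperplane then takes at `dΛ` one of at most
`(2M)^(n-d+1)` values, as only the small `z_j` with `j ∉ I` contribute. Over the prime field each
`I` excludes at most `(2M)^(n-d+1) p^(d-1)` of the `p^d` choices of `dΛ`, so the bound on `p` leaves
a good `Λ` (`exists_character_notMem_smallCombinations`). -/

theorem injective_of_det_ne_zero {n d : ℕ} {χ : Fin n → Fin d → ℤ} {e : Fin d → Fin n}
    (he : (Matrix.of (χ ∘ e)).det ≠ 0) : Function.Injective e := by
  intro i j hij
  by_contra hne
  exact he (Matrix.det_zero_of_row_eq hne (by ext; simp [hij]))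

/-- Gale duality: the weights `χ (e i)` are a rational basis exactly when the vectors `π(e_j)` with
`j` outside the range of `e` are one of the quotient. Unimodularity makes the latter an integral
basis, and this passes back to the weights. -/
theorem isUnit_det_of_ne_zero {n d : ℕ} {χ : Fin n → Fin d → ℤ} (hχ : IsUnimodular χ)
    {e : Fin d → Fin n} (he : (Matrix.of (χ ∘ e)).det ≠ 0) : IsUnit (Matrix.of (χ ∘ e)) := by
  have hinj := injective_of_det_ne_zero he
  set A : Matrix (Fin d) (Fin d) ℤ := Matrix.of (χ ∘ e) with hA
  have hmul : ∀ b i, (A.mulVec b) i = cocharMap χ b (e i) := fun b i => rfl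
  set q := (LinearMap.range (cocharMap χ)).mkQ with hq
  have hsum : ∀ w : Fin n → ℤ, q w = ∑ j, w j • q (Pi.single j 1) := by
    intro w
    conv_lhs => rw [pi_eq_sum_univ' w]
    rw [map_sum]
    refine Finset.sum_congr rfl fun j _ => ?_
    rw [← map_smul]
  -- A relation among these vectors is a cocharacter of `G` killed by every `χ (e i)`, hence zero.
  obtain ⟨ι, b, hb⟩ := hχ {j | j ∉ Set.range e} (by
    rw [linearIndepOn_iff]
    intro l hl h0
    have h1 : Finsupp.linearCombination ℤ (fun j => q (Pi.single j 1)) l = q l := by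
      rw [hsum, Finsupp.linearCombination_apply]
      exact Finsupp.sum_fintype _ _ fun j => zero_smul _ _
    rw [← hq, h1] at h0
    obtain ⟨c, hc⟩ := (Submodule.Quotient.mk_eq_zero _).mp h0
    have hc0 : c = 0 := by
      refine Matrix.eq_zero_of_mulVec_eq_zero he (funext fun i => ?_)
      rw [hmul, hc]
      by_contra hne
      exact hl (Finsupp.mem_support_iff.mpr hne) ⟨i, rfl⟩
    ext j
    rw [← congrFun hc j, hc0, map_zero]
    rfl)
  -- The basis `b` has no further members: by Cramer's rule `det A • b i` is a combination of the
  -- `π(e_j)` with `j` off the range of `e`. If `b i` were not among them, its `i`-th coordinate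
  -- `det A` would vanish.
  have hcover : ∀ i, ∃ j, j ∉ Set.range e ∧ q (Pi.single j 1) = b i := by
    intro i
    by_contra! hno
    obtain ⟨v, hv⟩ := (LinearMap.range (cocharMap χ)).mkQ_surjective (b i)
    set c := A.adjugate.mulVec (v ∘ e)
    set w := A.det • v - cocharMap χ c with hw
    have hw0 : ∀ i, w (e i) = 0 := by
      intro i
      have : A.mulVec c = A.det • (v ∘ e) := by
        simp [c, Matrix.mulVec_mulVec, Matrix.mul_adjugate]
      rw [hw, Pi.sub_apply, ← hmul, this]
      simp
    have hqw : q w = A.det • b i := by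
      have hc : q (cocharMap χ c) = 0 :=
        (Submodule.Quotient.mk_eq_zero _).mpr (LinearMap.mem_range_self _ c)
      rw [hw, map_sub, map_smul, ← hv, hc, sub_zero]
    have h1 := congrArg (b.coord i) hqw
    rw [hsum, map_sum] at h1
    have h2 : ∀ j, b.coord i (w j • q (Pi.single j 1)) = 0 := by
      intro j
      by_cases hj : j ∈ Set.range e
      · obtain ⟨i', rfl⟩ := hj
        simp [hw0]
      · obtain ⟨i', hi'⟩ := hb j hj
        have hne : i' ≠ i := by
          rintro rfl
          exact hno j hj hi'.symm
        rw [← hi']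
        simp [hne]
    rw [Finset.sum_eq_zero fun j _ => h2 j] at h1
    simp at h1
    exact he h1.symm
  rw [← Matrix.mulVec_surjective_iff_isUnit]
  let R : (Fin n → ℤ) →ₗ[ℤ] (Fin d → ℤ) := LinearMap.funLeft ℤ ℤ e
  -- Surjectivity of `A` is tested on the lattice of vectors whose restriction along `e` lies in the
  -- image of `A`. It surjects onto the quotient by `hcover`, and changing a vector by a cocharacter
  -- of `G` changes its restriction by an element of the image of `A`.
  let N : Submodule ℤ (Fin n → ℤ) := (LinearMap.range (R ∘ₗ cocharMap χ)).comap R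
  have htop : N.map q = ⊤ := by
    rw [eq_top_iff, ← b.span_eq, Submodule.span_le]
    rintro _ ⟨i, rfl⟩
    obtain ⟨j, hj, hji⟩ := hcover i
    refine ⟨Pi.single j 1, ?_, hji⟩
    have : R (Pi.single j 1) = 0 := by
      ext i
      have : e i ≠ j := fun h => hj ⟨i, h⟩
      simp [R, LinearMap.funLeft_apply, this]
    rw [SetLike.mem_coe, Submodule.mem_comap, this]
    exact zero_mem _
  intro u
  obtain ⟨v, rfl⟩ := LinearMap.funLeft_surjective_of_injective ℤ ℤ e hinj u
  obtain ⟨v', ⟨c', hc'⟩, hqv⟩ := (htop ▸ Submodule.mem_top : q v ∈ N.map q)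
  obtain ⟨c, hc⟩ := (Submodule.Quotient.eq _).mp hqv
  refine ⟨c' - c, ?_⟩
  have h1 : R (cocharMap χ (c' - c)) = R v := by
    rw [map_sub, map_sub, hc, map_sub]
    change (R ∘ₗ cocharMap χ) c' - _ = _
    rw [hc', sub_sub_cancel]
  exact h1

theorem exists_sum_smul_eq {n d : ℕ} {χ : Fin n → Fin d → ℤ} (hχ : IsUnimodular χ)
    {e : Fin d → Fin n} (he : (Matrix.of (χ ∘ e)).det ≠ 0) (δ : Fin d → ℤ) :
    ∃ a : Fin d → ℤ, ∑ i, a i • χ (e i) = δ := by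
  obtain ⟨a, ha⟩ := Matrix.vecMul_surjective_iff_isUnit.mpr (isUnit_det_of_ne_zero hχ he) δ
  refine ⟨a, ?_⟩
  rw [← ha]
  exact (Matrix.vecMul_eq_sum _ _).symm

/-- The weights over a ring. -/
def castWeight (F : Type*) [Ring F] {n d : ℕ} (χ : Fin n → Fin d → ℤ) (j : Fin n) : Fin d → F :=
  fun i => (χ j i : F)

/-- The field may have characteristic `p`: the determinant over `F` is the image of the integral
one. This carries bases found over `k` back to `ℤ`. -/
theorem det_ne_zero_of_linearIndependent {F : Type*} [Field F] {n d : ℕ}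
    {χ : Fin n → Fin d → ℤ} {e : Fin d → Fin n}
    (h : LinearIndependent F (castWeight F χ ∘ e)) : (Matrix.of (χ ∘ e)).det ≠ 0 := by
  intro h0
  have h1 : ((Matrix.of (χ ∘ e)).map (Int.castRingHom F)).det = 0 := by
    rw [← RingHom.mapMatrix_apply, ← RingHom.map_det, h0, map_zero]
  have h2 : IsUnit ((Matrix.of (χ ∘ e)).map (Int.castRingHom F)) :=
    Matrix.linearIndependent_rows_iff_isUnit.mp h
  rw [Matrix.isUnit_iff_isUnit_det, h1] at h2
  exact not_isUnit_zero h2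

theorem linearIndependent_castWeight {F : Type*} [Field F] [CharZero F] {n d : ℕ}
    {χ : Fin n → Fin d → ℤ} {e : Fin d → Fin n} (he : (Matrix.of (χ ∘ e)).det ≠ 0) :
    LinearIndependent F (castWeight F χ ∘ e) := by
  refine Matrix.linearIndependent_rows_of_det_ne_zero
    (A := (Matrix.of (χ ∘ e)).map (Int.castRingHom F)) ?_
  rw [← RingHom.mapMatrix_apply, ← RingHom.map_det]
  simpa using he

theorem span_castWeight (F : Type*) [Field F] {n d : ℕ} {χ : Fin n → Fin d → ℤ}
    (hspan : Submodule.span ℤ (Set.range χ) = ⊤) :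
    Submodule.span F (Set.range (castWeight F χ)) = ⊤ := by
  have hcast : ∀ v ∈ Submodule.span ℤ (Set.range χ),
      (fun i => (v i : F)) ∈ Submodule.span F (Set.range (castWeight F χ)) := by
    intro v hv
    induction hv using Submodule.span_induction with
    | mem v hv =>
      obtain ⟨j, rfl⟩ := hv
      exact Submodule.subset_span ⟨j, rfl⟩
    | zero =>
      simp only [Pi.zero_apply, Int.cast_zero]
      exact zero_mem _
    | add v w _ _ hv hw => convert add_mem hv hw using 1; ext; simp
    | smul r v _ hv => convert Submodule.smul_mem _ (r : F) hv using 1; ext; simp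
  rw [eq_top_iff, ← (Pi.basisFun F (Fin d)).span_eq, Submodule.span_le]
  rintro _ ⟨i, rfl⟩
  have := hcast (Pi.single i 1) (hspan ▸ Submodule.mem_top)
  convert! this using 1
  ext i'
  by_cases h : i' = i
  · subst h; simp
  · simp [h]

/-- Either the weights in `S` contain a basis, or they lie in the span of `d - 1` members of a
basis of weights. -/
theorem exists_basis_or_subset_hyperplane {F : Type*} [Field F] {n d : ℕ}
    {v : Fin n → Fin d → F} (hv : Submodule.span F (Set.range v) = ⊤) (S : Set (Fin n)) :
    (∃ e : Fin d → Fin n, (∀ i, e i ∈ S) ∧ LinearIndependent F (v ∘ e)) ∨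
    ∃ (e : Fin d → Fin n) (i₀ : Fin d), LinearIndependent F (v ∘ e) ∧
      ∀ j ∈ S, v j ∈ Submodule.span F ((v ∘ e) '' {i₀}ᶜ) := by
  -- `I` is a maximal independent subset of `S`, and `J` extends it to a basis. If `J` is larger
  -- than `I`, any element of `J` outside `I` can serve as the omitted member.
  obtain ⟨I, hIS, -, hspanI, hI⟩ :=
    exists_linearIndepOn_extension (linearIndepOn_empty F v) (Set.empty_subset S)
  obtain ⟨J, -, hIJ, hspanJ, hJ⟩ := exists_linearIndepOn_extension hI (Set.subset_univ I)
  have htop : Submodule.span F (Set.range fun j : J => v j) = ⊤ := by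
    rw [eq_top_iff, ← hv, Submodule.span_le, ← Set.image_univ]
    refine hspanJ.trans (le_of_eq ?_)
    congr 2
    ext; simp
  classical
  have hcard : Fintype.card J = d := by
    have := Module.finrank_eq_card_basis (Module.Basis.mk hJ htop.ge)
    simpa using this.symm
  let f : Fin d ≃ J := (Fintype.equivFinOfCardEq hcard).symm
  have hlin : LinearIndependent F (v ∘ fun i => (f i : Fin n)) := hJ.comp f f.injective
  by_cases hJI : J ⊆ I
  · exact Or.inl ⟨fun i => f i, fun i => hIS (hJI (f i).2), hlin⟩
  · obtain ⟨j₀, hj₀, hj₀I⟩ := Set.not_subset.mp hJI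
    refine Or.inr ⟨fun i => f i, f.symm ⟨j₀, hj₀⟩, hlin, fun j hj => ?_⟩
    refine Submodule.span_mono ?_ (hspanI ⟨j, hj, rfl⟩)
    rintro _ ⟨i, hi, rfl⟩
    refine ⟨f.symm ⟨i, hIJ hi⟩, ?_, by simp⟩
    rw [Set.mem_compl_singleton_iff, f.symm.injective.ne_iff]
    rintro h
    rw [Subtype.mk.injEq] at h
    exact hj₀I (h ▸ hi)

/-! ### Vertices -/

theorem exists_pos_add_smul_sub_nonneg {ι : Type*} [Fintype ι] {v w : ι → ℝ} (hv : ∀ c, 0 ≤ v c)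
    (hsupp : ∀ c, v c = 0 → w c = 0) :
    ∃ ε > 0, ∀ c, 0 ≤ v c + ε * (v c - w c) ∧ 0 ≤ v c - ε * (v c - w c) := by
  have h : ∀ c, ∀ᶠ ε in nhdsWithin (0 : ℝ) (Set.Ioi 0),
      0 ≤ v c + ε * (v c - w c) ∧ 0 ≤ v c - ε * (v c - w c) := by
    intro c
    rcases (hv c).eq_or_lt with h0 | h0
    · simp [← h0, hsupp c h0.symm]
    · have h1 : Continuous fun ε : ℝ => v c + ε * (v c - w c) := by fun_prop
      have h2 : Continuous fun ε : ℝ => v c - ε * (v c - w c) := by fun_prop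
      refine Filter.Eventually.filter_mono nhdsWithin_le_nhds ?_
      filter_upwards [h1.continuousAt.eventually_const_lt (u := 0) (by simpa using h0),
        h2.continuousAt.eventually_const_lt (u := 0) (by simpa using h0)] with ε h1 h2
        using ⟨h1.le, h2.le⟩
  obtain ⟨ε, hε, hpos⟩ := ((Filter.eventually_all.mpr h).and self_mem_nhdsWithin).exists
  exact ⟨ε, hpos, hε⟩

/-- A vertex is determined by its support: if `v` and `w` have the same support, then `v ± ε(v - w)`
remains in the polyhedron for small `ε > 0`, so extremality of `v` forces `v = w`. -/
theorem finite_extremePoints {n d : ℕ} (χ : Fin n → Fin d → ℤ) (δ : Fin d → ℤ) :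
    (Set.extremePoints ℝ (polyhedron χ δ)).Finite := by
  refine Set.Finite.of_injOn (f := Function.support) (t := Set.univ)
    (Set.mapsTo_univ _ _) ?_ Set.finite_univ
  intro v hv w hw hvw
  have hsupp : ∀ c, v c = 0 → w c = 0 := fun c => by
    have := Set.ext_iff.mp hvw c
    simp only [Function.mem_support] at this
    tauto
  obtain ⟨ε, hε, h⟩ := exists_pos_add_smul_sub_nonneg hv.1.2 hsupp
  have hlin : ∀ s : ℝ, ∀ i, ∑ j, ((v (Sum.inl j) + s * (v (Sum.inl j) - w (Sum.inl j)))
      - (v (Sum.inr j) + s * (v (Sum.inr j) - w (Sum.inr j)))) * (χ j i : ℝ) = δ i := by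
    intro s i
    have h1 := hv.1.1 i
    have h2 := hw.1.1 i
    calc _ = (1 + s) * ∑ j, (v (Sum.inl j) - v (Sum.inr j)) * (χ j i : ℝ)
          - s * ∑ j, (w (Sum.inl j) - w (Sum.inr j)) * (χ j i : ℝ) := by
          rw [Finset.mul_sum, Finset.mul_sum, ← Finset.sum_sub_distrib]
          exact Finset.sum_congr rfl fun j _ => by ring
      _ = _ := by rw [h1, h2]; ring
  have hmem := mem_extremePoints.mp hv
  have h1 := (hmem.2 (fun c => v c + ε * (v c - w c)) ⟨hlin ε, fun c => (h c).1⟩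
    (fun c => v c + (-ε) * (v c - w c)) ⟨hlin (-ε), fun c => by
      have := (h c).2
      linarith⟩ ⟨1 / 2, 1 / 2, by norm_num, by norm_num, by norm_num, by
        ext c
        simp
        ring⟩).1
  ext c
  have h2 := congrFun h1 c
  simp only [add_eq_left, mul_eq_zero, hε.ne', false_or] at h2
  linarith

/-- Without boundedness, `sSup` would take its default value `0` and `vertexBound` would bound
nothing. -/
theorem bddAbove_vertices {n d : ℕ} (χ : Fin n → Fin d → ℤ) (δ : Fin d → ℤ) :
    BddAbove {r | ∃ v ∈ Set.extremePoints ℝ (polyhedron χ δ), ∃ c, r = |v c|} := by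
  refine Set.Finite.bddAbove ?_
  refine (((finite_extremePoints χ δ).prod (Set.finite_univ (α := Fin n ⊕ Fin n))).image
    fun vc => |vc.1 vc.2|).subset ?_
  rintro _ ⟨v, hv, c, rfl⟩
  exact ⟨(v, c), ⟨hv, trivial⟩, rfl⟩

theorem vertexBound_nonneg {n d : ℕ} (χ : Fin n → Fin d → ℤ) (δ : Fin d → ℤ) :
    0 ≤ vertexBound χ δ := by
  refine Real.sSup_nonneg ?_
  rintro _ ⟨v, -, c, rfl⟩
  exact abs_nonneg _

/-- The point of the polyhedron with coordinates the positive and negative parts of `a`. -/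
def signedPoint {n : ℕ} (a : Fin n → ℝ) : Fin n ⊕ Fin n → ℝ :=
  Sum.elim (fun j => (a j)⁺) (fun j => (a j)⁻)

/-- The support meets each pair of coordinates at most once and involves only independent weights.
Hence no other point of the polyhedron is supported there, while the endpoints of an open segment
through the point must be. -/
theorem signedPoint_mem_extremePoints {n d : ℕ} {χ : Fin n → Fin d → ℤ} {e : Fin d → Fin n}
    (he : (Matrix.of (χ ∘ e)).det ≠ 0) {a : Fin n → ℝ} (ha : ∀ j, j ∉ Set.range e → a j = 0)
    {δ : Fin d → ℤ} (hδ : ∀ i, ∑ j, a j * (χ j i : ℝ) = δ i) :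
    signedPoint a ∈ Set.extremePoints ℝ (polyhedron χ δ) := by
  have hmem : signedPoint a ∈ polyhedron χ δ := by
    refine ⟨fun i => ?_, ?_⟩
    · simpa [signedPoint] using hδ i
    · rintro (j | j)
      · exact posPart_nonneg _
      · exact negPart_nonneg _
  have hlin := linearIndependent_castWeight (F := ℝ) he
  have hinj := injective_of_det_ne_zero he
  have huniq : ∀ y ∈ polyhedron χ δ, (∀ c, signedPoint a c = 0 → y c = 0) →
      y = signedPoint a := by
    intro y hy hsupp
    have hy0 : ∀ j, j ∉ Set.range e → y (Sum.inl j) - y (Sum.inr j) - a j = 0 := by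
      intro j hj
      rw [hsupp (Sum.inl j) (by simp [signedPoint, ha j hj]),
        hsupp (Sum.inr j) (by simp [signedPoint, ha j hj]), ha j hj]
      simp
    have hrel : ∑ i, (y (Sum.inl (e i)) - y (Sum.inr (e i)) - a (e i)) •
        castWeight ℝ χ (e i) = 0 := by
      rw [Fintype.sum_of_injective e hinj _
        (fun j => (y (Sum.inl j) - y (Sum.inr j) - a j) • castWeight ℝ χ j)
        (fun j hj => by rw [hy0 j hj, zero_smul]) (fun i => rfl)]
      ext i
      have h1 := hy.1 i
      have h2 := hδ i
      simp only [Finset.sum_apply, Pi.smul_apply, smul_eq_mul, castWeight, Pi.zero_apply]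
      simp only [sub_mul _ (a _), Finset.sum_sub_distrib]
      rw [h1, h2, sub_self]
    have hrel' := Fintype.linearIndependent_iff.mp hlin _ hrel
    have hdiff : ∀ j, y (Sum.inl j) - y (Sum.inr j) = a j := by
      intro j
      by_cases hj : j ∈ Set.range e
      · obtain ⟨i, rfl⟩ := hj
        exact sub_eq_zero.mp (hrel' i)
      · exact sub_eq_zero.mp (hy0 j hj)
    ext c
    rcases c with j | j <;> have h1 := hdiff j <;> rcases le_total 0 (a j) with h | h
    · rw [hsupp (Sum.inr j) (by simpa [signedPoint] using h)] at h1
      simpa [signedPoint, posPart_eq_self.mpr h] using h1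
    · have h2 := hsupp (Sum.inl j) (by simpa [signedPoint] using h)
      rw [h2]
      simp [signedPoint, posPart_eq_zero.mpr h]
    · have h2 := hsupp (Sum.inr j) (by simpa [signedPoint] using h)
      rw [h2]
      simp [signedPoint, negPart_eq_zero.mpr h]
    · rw [hsupp (Sum.inl j) (by simpa [signedPoint] using h)] at h1
      simp only [signedPoint, Sum.elim_inr, negPart_eq_neg.mpr h]
      linarith
  refine mem_extremePoints.mpr ⟨hmem, ?_⟩
  rintro y hy z hz ⟨α, β, hα, hβ, -, hyz⟩
  have hzero : ∀ c, signedPoint a c = 0 → y c = 0 ∧ z c = 0 := by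
    intro c hc
    have h1 := congrFun hyz c
    rw [hc] at h1
    simp only [Pi.add_apply, Pi.smul_apply, smul_eq_mul] at h1
    have h2 := mul_nonneg hα.le (hy.2 c)
    have h3 := mul_nonneg hβ.le (hz.2 c)
    exact ⟨(mul_eq_zero.mp (by linarith : α * y c = 0)).resolve_left hα.ne',
      (mul_eq_zero.mp (by linarith : β * z c = 0)).resolve_left hβ.ne'⟩
  exact ⟨huniq y hy fun c hc => (hzero c hc).1, huniq z hz fun c hc => (hzero c hc).2⟩

/-- A character has integral coordinates, bounded by `vertexBound`, in every basis of weights. -/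
theorem exists_bounded_coordinates {n d : ℕ} {χ : Fin n → Fin d → ℤ} (hχ : IsUnimodular χ)
    {e : Fin d → Fin n} (he : (Matrix.of (χ ∘ e)).det ≠ 0) (δ : Fin d → ℤ) :
    ∃ a : Fin n → ℤ, (∀ j, j ∉ Set.range e → a j = 0) ∧ ∑ j, a j • χ j = δ ∧
      ∀ j, (|a j| : ℝ) ≤ vertexBound χ δ := by
  have hinj := injective_of_det_ne_zero he
  obtain ⟨b, hb⟩ := exists_sum_smul_eq hχ he δ
  have ha0 : ∀ j, j ∉ Set.range e → Function.extend e b 0 j = 0 := fun j hj =>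
    Function.extend_apply' _ _ _ fun ⟨i, hi⟩ => hj ⟨i, hi⟩
  have hsum : ∑ j, Function.extend e b 0 j • χ j = δ := by
    rw [← hb]
    exact (Fintype.sum_of_injective e hinj _ _ (fun j hj => by rw [ha0 j hj, zero_smul])
      fun i => by rw [hinj.extend_apply]).symm
  refine ⟨Function.extend e b 0, ha0, hsum, fun j => ?_⟩
  set a := Function.extend e b 0
  have hvert := signedPoint_mem_extremePoints he (a := fun j => (a j : ℝ))
    (fun j hj => by simp [ha0 j hj]) (δ := δ) (fun i => by
      rw [← hsum]
      simp)
  rcases le_total 0 (a j : ℝ) with h | h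
  · exact le_csSup (bddAbove_vertices χ δ) ⟨_, hvert, Sum.inl j, by
      simp [signedPoint, posPart_eq_self.mpr h]⟩
  · exact le_csSup (bddAbove_vertices χ δ) ⟨_, hvert, Sum.inr j, by
      simp [signedPoint, negPart_eq_neg.mpr h]⟩

/-! ### Generic characters -/

theorem exists_ne_zero_forall_dotProduct_eq_zero {F : Type*} [Field F] {n d : ℕ}
    (v : Fin n → Fin d → F) {I : Finset (Fin n)} (hI : I.card < d) :
    ∃ b : Fin d → F, b ≠ 0 ∧ ∀ j ∈ I, v j ⬝ᵥ b = 0 := by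
  let A : Matrix I (Fin d) F := Matrix.of fun j => v j
  have hker : LinearMap.ker A.mulVecLin ≠ ⊥ :=
    LinearMap.ker_ne_bot_of_finrank_lt (by simpa using hI)
  obtain ⟨b, hb, hb0⟩ := Submodule.exists_mem_ne_zero_of_ne_bot hker
  exact ⟨b, hb0, fun j hj => congrFun hb ⟨j, hj⟩⟩

/-- A rational solution with its denominators cleared. -/
theorem exists_int_ne_zero_forall_dotProduct_eq_zero {n d : ℕ} (χ : Fin n → Fin d → ℤ)
    {I : Finset (Fin n)} (hI : I.card < d) :
    ∃ b : Fin d → ℤ, b ≠ 0 ∧ ∀ j ∈ I, χ j ⬝ᵥ b = 0 := by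
  obtain ⟨b, hb0, hb⟩ := exists_ne_zero_forall_dotProduct_eq_zero (castWeight ℚ χ) hI
  obtain ⟨m, hm⟩ := IsLocalization.exist_integer_multiples_of_finite (nonZeroDivisors ℤ) b
  choose c hc using hm
  have hm0 : ((m : ℤ) : ℚ) ≠ 0 := by exact_mod_cast nonZeroDivisors.ne_zero m.2
  have hcb : ∀ i, (c i : ℚ) = (m : ℤ) * b i := fun i => by
    rw [← eq_intCast (algebraMap ℤ ℚ), hc i, Algebra.smul_def]
    rfl
  refine ⟨c, ?_, fun j hj => ?_⟩
  · rintro rfl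
    refine hb0 (funext fun i => ?_)
    simpa [hm0] using (hcb i).symm
  · have h : ((χ j ⬝ᵥ c : ℤ) : ℚ) = (m : ℤ) * (castWeight ℚ χ j ⬝ᵥ b) := by
      simp only [dotProduct, castWeight, Int.cast_sum, Int.cast_mul, hcb, Finset.mul_sum]
      exact Finset.sum_congr rfl fun i _ => by ring
    rw [hb j hj, mul_zero] at h
    exact_mod_cast h

/-- A product of nonzero linear forms is a nonzero polynomial, so it does not vanish at all integral
points. -/
theorem exists_forall_dotProduct_ne_zero {d : ℕ} (s : Finset (Fin d → ℤ)) (hs : 0 ∉ s) :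
    ∃ δ : Fin d → ℤ, ∀ b ∈ s, δ ⬝ᵥ b ≠ 0 := by
  let P : (Fin d → ℤ) → MvPolynomial (Fin d) ℤ :=
    fun b => ∑ i, MvPolynomial.X i * MvPolynomial.C (b i)
  have heval : ∀ δ b, MvPolynomial.eval δ (P b) = δ ⬝ᵥ b := fun δ b => by
    simp [P, dotProduct]
  have hP : ∏ b ∈ s, P b ≠ 0 := by
    refine Finset.prod_ne_zero_iff.mpr fun b hb h0 => ?_
    have hb0 : b = 0 := by
      ext i
      have := heval (Pi.single i 1) b
      rw [h0] at this
      simpa using this.symm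
    exact hs (hb0 ▸ hb)
  by_contra! h
  refine hP (MvPolynomial.funext fun δ => ?_)
  obtain ⟨b, hb, h0⟩ := h δ
  rw [map_prod, map_zero]
  exact Finset.prod_eq_zero hb ((heval δ b).trans h0)

/-- Each wall and each span to be avoided lies in the orthogonal complement of a nonzero integral
vector, and there are finitely many of them. Existence also ensures that `minBound` is not the
infimum of the empty set. -/
theorem exists_isGeneric {n d : ℕ} (hd : 0 < d) (χ : Fin n → Fin d → ℤ) :
    ∃ δ, IsGeneric χ δ := by
  classical
  have hone : (Pi.single ⟨0, hd⟩ 1 : Fin d → ℤ) ≠ 0 := by simp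
  have h1 : ∀ I : Finset (Fin n), ∃ b : Fin d → ℤ, b ≠ 0 ∧
      (Module.finrank ℤ (subCochar χ I) = 1 → b ∈ subCochar χ I) := by
    intro I
    by_cases hI : Module.finrank ℤ (subCochar χ I) = 1
    · have hne : subCochar χ I ≠ ⊥ := by
        intro h
        rw [h, finrank_bot] at hI
        exact zero_ne_one hI
      obtain ⟨b, hb, hb0⟩ := Submodule.exists_mem_ne_zero_of_ne_bot hne
      exact ⟨b, hb0, fun _ => hb⟩
    · exact ⟨_, hone, fun h => absurd h hI⟩
  have h2 : ∀ I : Finset (Fin n), ∃ b : Fin d → ℤ, b ≠ 0 ∧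
      (I.card < d → ∀ j ∈ I, χ j ⬝ᵥ b = 0) := by
    intro I
    by_cases hI : I.card < d
    · obtain ⟨b, hb0, hb⟩ := exists_int_ne_zero_forall_dotProduct_eq_zero χ hI
      exact ⟨b, hb0, fun _ => hb⟩
    · exact ⟨_, hone, fun h => absurd h hI⟩
  choose b hb0 hb using h1
  choose c hc0 hc using h2
  obtain ⟨δ, hδ⟩ := exists_forall_dotProduct_ne_zero
    (Finset.univ.image b ∪ Finset.univ.image c) (by simp [hb0, hc0])
  refine ⟨δ, fun I hI hwall => ?_, fun I hI hspan => ?_⟩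
  · exact hδ (b I) (by simp) (hwall _ (hb I hI))
  · refine hδ (c I) (by simp) ?_
    clear hδ
    induction hspan using Submodule.span_induction with
    | mem v hv =>
      obtain ⟨j, hj, rfl⟩ := hv
      exact hc I hI j hj
    | zero => exact zero_dotProduct _
    | add v w _ _ hv hw => rw [add_dotProduct, hv, hw, add_zero]
    | smul r v _ hv => rw [smul_dotProduct, hv, smul_zero]

/-- Some generic character has a vertex bound as close to `minBound` as desired. -/
theorem exists_isGeneric_vertexBound_mem {n d : ℕ} (hd : 0 < d) (χ : Fin n → Fin d → ℤ)
    {s : Set ℝ} (hs : IsOpen s) (hmem : minBound χ ∈ s) :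
    ∃ δ, IsGeneric χ δ ∧ vertexBound χ δ ∈ s := by
  obtain ⟨δ₀, hδ₀⟩ := exists_isGeneric hd χ
  -- An infimum lies in the closure of its set, so its attainment is not needed.
  have hcl : minBound χ ∈ closure {r | ∃ δ, IsGeneric χ δ ∧ r = vertexBound χ δ} := by
    refine csInf_mem_closure ⟨_, δ₀, hδ₀, rfl⟩ ⟨0, ?_⟩
    rintro _ ⟨δ, -, rfl⟩
    exact vertexBound_nonneg χ δ
  obtain ⟨_, hr, δ, hδ, rfl⟩ := mem_closure_iff.mp hcl s hs hmem
  exact ⟨δ, hδ, hr⟩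

/-! ### Smooth parameters -/

theorem chr_single {R : Type*} [CommRing R] {d : ℕ} (i : Fin d) (t : Fin d → Rˣ) :
    chr (Pi.single i 1) t = t i := by
  unfold chr
  rw [Finset.prod_eq_single i (fun j _ hj => by simp [hj]) (by simp)]
  simp

theorem coeff_aeval_C_mul_X {σ k : Type*} [Fintype σ] [CommRing k] (u : σ → k)
    (s : MvPolynomial σ k) (m : σ →₀ ℕ) :
    (MvPolynomial.aeval (fun c => MvPolynomial.C (u c) * MvPolynomial.X c) s).coeff m
      = (∏ c, u c ^ m c) * s.coeff m := by
  classical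
  induction s using MvPolynomial.induction_on' with
  | monomial e a =>
    have : MvPolynomial.aeval (fun c => MvPolynomial.C (u c) * MvPolynomial.X c)
        (MvPolynomial.monomial e a)
        = MvPolynomial.C (∏ c, u c ^ e c) * MvPolynomial.monomial e a := by
      rw [MvPolynomial.aeval_monomial, MvPolynomial.monomial_eq,
        Finsupp.prod_fintype _ _ (fun _ => pow_zero _),
        Finsupp.prod_fintype _ _ (fun _ => pow_zero _)]
      simp only [mul_pow, Finset.prod_mul_distrib, map_prod, map_pow,
        MvPolynomial.algebraMap_eq]
      ring
    rw [this, MvPolynomial.coeff_C_mul, MvPolynomial.coeff_monomial]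
    split_ifs with h
    · rw [h]
    · simp
  | add p q hp hq => rw [map_add, MvPolynomial.coeff_add, hp, hq, MvPolynomial.coeff_add, mul_add]

theorem chr_sum_smul {R : Type*} [CommRing R] {d : ℕ} {ι : Type*} (s : Finset ι) (m : ι → ℕ)
    (w : ι → Fin d → ℤ) (t : Fin d → Rˣ) :
    chr (∑ c ∈ s, m c • w c) t = ∏ c ∈ s, chr (w c) t ^ m c := by
  classical
  have hsmul : ∀ (m : ℕ) (a : Fin d → ℤ), chr (m • a) t = chr a t ^ m := by
    intro m a
    induction m with
    | zero => rw [zero_smul, chr_zero, pow_zero]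
    | succ m ih => rw [succ_nsmul, chr_add, ih, pow_succ]
  induction s using Finset.induction_on with
  | empty => simp [chr_zero]
  | insert c s hc ih => rw [Finset.sum_insert hc, Finset.prod_insert hc, chr_add, ih, hsmul]

/-- The torus acts diagonally on monomials, and over an infinite field distinct characters are
distinct functions. -/
theorem weight_of_mem_support {k : Type*} [Field k] [Infinite k] {n d : ℕ}
    {χ : Fin n → Fin d → ℤ} {a : Fin d → ℤ} {s : MvPolynomial (Fin n ⊕ Fin n) k}
    (hs : s ∈ semiInvFun k χ a) {m : Fin n ⊕ Fin n →₀ ℕ} (hm : m ∈ s.support) :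
    ∑ c, m c • weight χ c = a := by
  refine chr_injective k d (funext fun t => ?_)
  have h := congrArg (MvPolynomial.coeff m) (hs t)
  rw [coeff_aeval_C_mul_X, MvPolynomial.coeff_C_mul] at h
  have h' := mul_right_cancel₀ (MvPolynomial.mem_support_iff.mp hm) h
  dsimp only
  rw [← h', chr_sum_smul]
  simp

/-- The index of the pair of coordinates to which a coordinate of `T^*X` belongs. -/
def coordIndex {n : ℕ} : Fin n ⊕ Fin n → Fin n := Sum.elim id id

theorem weight_eq_or_eq_neg {n d : ℕ} (χ : Fin n → Fin d → ℤ) (c : Fin n ⊕ Fin n) :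
    weight χ c = χ (coordIndex c) ∨ weight χ c = -χ (coordIndex c) := by
  rcases c with j | j
  · exact Or.inl rfl
  · exact Or.inr rfl

/-- The weights occurring in a monomial of weight a positive multiple of a generic character
contain a basis. -/
theorem exists_basis_of_isGeneric {n d : ℕ} {χ : Fin n → Fin d → ℤ}
    (hspan : Submodule.span ℤ (Set.range χ) = ⊤) (hχ : IsUnimodular χ) {δ : Fin d → ℤ}
    (hδ : IsGeneric χ δ) {m : ℕ} (hm : 0 < m) {f : Fin n ⊕ Fin n →₀ ℕ}
    (hf : ∑ c, f c • weight χ c = m • δ) :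
    ∃ e : Fin d → Fin n, (∀ i, ∃ c, f c ≠ 0 ∧ coordIndex c = e i) ∧
      (Matrix.of (χ ∘ e)).det ≠ 0 := by
  classical
  rcases exists_basis_or_subset_hyperplane (span_castWeight ℚ hspan)
    {j | ∃ c, f c ≠ 0 ∧ coordIndex c = j} with ⟨e, heS, he⟩ | ⟨e, i₀, he, hS⟩
  · exact ⟨e, heS, det_ne_zero_of_linearIndependent he⟩
  exfalso
  have hdet := det_ne_zero_of_linearIndependent he
  obtain ⟨a, ha⟩ := exists_sum_smul_eq hχ hdet δ
  set H := Submodule.span ℚ ((castWeight ℚ χ ∘ e) '' {i₀}ᶜ)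
  have hmem : (fun i => ((m • δ) i : ℚ)) ∈ H := by
    have : (fun i => ((m • δ) i : ℚ)) = ∑ c, (f c : ℚ) • fun i => (weight χ c i : ℚ) := by
      rw [← hf]
      ext i
      simp
    rw [this]
    refine Submodule.sum_mem _ fun c _ => ?_
    by_cases hc : f c = 0
    · simp [hc]
    refine Submodule.smul_mem _ _ ?_
    have h := hS (coordIndex c) ⟨c, hc, rfl⟩
    rcases weight_eq_or_eq_neg χ c with hw | hw
    · rw [hw]
      exact h
    · rw [hw]
      convert neg_mem h using 1
      ext i
      simp [castWeight]
  -- `mδ` lies in the hyperplane `H` (the signs of the weights do not matter there), so the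
  -- coordinate of `δ` along the omitted basis weight vanishes. As the coordinates are integral, `δ`
  -- is then in the `ℤ`-span of `d - 1` weights.
  have ha0 : a i₀ = 0 := by
    by_contra hne
    refine he.notMem_span_image (s := {i₀}ᶜ) (x := i₀) (by simp) ?_
    have hsum : (fun i => ((m • δ) i : ℚ)) = ∑ i, ((m * a i : ℤ) : ℚ) • castWeight ℚ χ (e i) := by
      rw [← ha]
      ext i
      simp [castWeight, Finset.mul_sum, mul_assoc]
    rw [hsum, ← Finset.add_sum_erase _ _ (Finset.mem_univ i₀)] at hmem
    rw [Submodule.add_mem_iff_left] at hmem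
    · refine (Submodule.smul_mem_iff _ ?_).mp hmem
      exact_mod_cast mul_ne_zero (by exact_mod_cast hm.ne') hne
    · refine Submodule.sum_mem _ fun i hi => Submodule.smul_mem _ _ (Submodule.subset_span ?_)
      exact ⟨i, Finset.ne_of_mem_erase hi, rfl⟩
  refine hδ.2 ((Finset.univ.erase i₀).image e) ?_ ?_
  · rw [Finset.card_image_of_injective _ (injective_of_det_ne_zero hdet),
      Finset.card_erase_of_mem (Finset.mem_univ _), Finset.card_univ, Fintype.card_fin]
    exact Nat.sub_lt i₀.pos one_pos
  · rw [← ha, ← Finset.add_sum_erase _ _ (Finset.mem_univ i₀), ha0, zero_smul, zero_add]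
    refine Submodule.sum_mem _ fun i hi => Submodule.smul_mem _ _ (Submodule.subset_span ?_)
    exact ⟨e i, by simpa using ⟨i, Finset.ne_of_mem_erase hi, rfl⟩, rfl⟩

/-- The characters that act trivially on an element of `R` at a point of `G(R)`. -/
def fixingCharacters {R : Type*} [CommRing R] {d : ℕ} (t : Fin d → Rˣ) (r : R) :
    AddSubgroup (Fin d → ℤ) where
  carrier := {a | ((chr a t : Rˣ) : R) * r = r}
  zero_mem' := by simp [chr_zero]
  add_mem' := by
    intro a b ha hb
    rw [Set.mem_ofPred_eq, chr_add, Units.val_mul, mul_assoc, hb, ha]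
  neg_mem' := by
    intro a ha
    rw [Set.mem_ofPred_eq, chr_neg, Units.inv_mul_eq_iff_eq_mul]
    exact ha.symm

/-- Over a general ring a semistable point need not have an invertible monomial. Instead, each `t i
- 1` annihilates the value of every monomial of weight `mδ`, and these values generate the unit
ideal. -/
theorem isSmoothParameter_of_isGeneric (k : Type*) [Field k] [Infinite k] {n d : ℕ}
    {χ : Fin n → Fin d → ℤ} (hspan : Submodule.span ℤ (Set.range χ) = ⊤)
    (hχ : IsUnimodular χ) {δ : Fin d → ℤ} (hδ : IsGeneric χ δ) : IsSmoothParameter k χ δ := by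
  intro R _ _ y _ hss t ht
  have hmon : ∀ (m : ℕ), 0 < m → ∀ f : Fin n ⊕ Fin n →₀ ℕ, ∑ c, f c • weight χ c = m • δ →
      ∀ i, (t i : R) * (f.prod fun c e => y c ^ e) = f.prod fun c e => y c ^ e := by
    intro m hm f hf i
    set r := f.prod fun c e => y c ^ e with hr
    have hw : ∀ c, f c ≠ 0 → weight χ c ∈ fixingCharacters t r := by
      intro c hc
      -- The character `weight χ c` is trivial on `y c`, hence on all multiples of `y c`.
      have hdvd : y c ∣ r :=
        (dvd_pow_self _ hc).trans (Finset.dvd_prod_of_mem _ (Finsupp.mem_support_iff.mpr hc))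
      obtain ⟨z, hz⟩ := hdvd
      change _ * r = r
      rw [hz, ← mul_assoc]
      exact congrArg (· * z) (congrFun ht c)
    obtain ⟨e, he, hdet⟩ := exists_basis_of_isGeneric hspan hχ hδ hm hf
    have he' : ∀ i, χ (e i) ∈ fixingCharacters t r := by
      intro i
      obtain ⟨c, hc, hce⟩ := he i
      rw [← hce]
      rcases weight_eq_or_eq_neg χ c with h | h
      · exact h ▸ hw c hc
      · exact neg_mem_iff.mp (h ▸ hw c hc)
    obtain ⟨a, ha⟩ := exists_sum_smul_eq hχ hdet (Pi.single i 1)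
    have hi : (Pi.single i 1 : Fin d → ℤ) ∈ fixingCharacters t r := by
      rw [← ha]
      exact sum_mem fun i _ => zsmul_mem (he' i) _
    rw [← chr_single i t]
    exact hi
  ext i
  -- The annihilator of `t i - 1`.
  let J : Ideal R := LinearMap.ker (LinearMap.mulLeft R ((t i : R) - 1))
  have hJ : J = ⊤ := by
    rw [eq_top_iff, ← (show Ideal.span _ = ⊤ from hss), Ideal.span_le]
    rintro _ ⟨m, hm, s, hs, rfl⟩
    rw [MvPolynomial.aeval_def, MvPolynomial.eval₂_eq']
    refine sum_mem fun f hf => Ideal.mul_mem_left _ _ ?_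
    have := hmon m hm f (weight_of_mem_support hs hf) i
    rw [Finsupp.prod_fintype _ _ (fun _ => pow_zero _)] at this
    simp only [J, LinearMap.mem_ker, LinearMap.mulLeft_apply]
    rw [sub_mul, one_mul, this, sub_self]
  have h1 : (1 : R) ∈ J := hJ ▸ Submodule.mem_top
  simpa [J, sub_eq_zero] using h1

/-! ### Euler operators -/

/-- Evaluation of polynomials at a commuting family in a noncommutative algebra. -/
theorem exists_algHom_of_commute {k A ι : Type*} [CommRing k] [Ring A] [Algebra k A] (θ : ι → A)
    (h : ∀ i j, Commute (θ i) (θ j)) :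
    ∃ ψ : MvPolynomial ι k →ₐ[k] A, ∀ i, ψ (MvPolynomial.X i) = θ i := by
  have hcomm : IsMulCommutative (Algebra.adjoin k (Set.range θ)) := by
    refine Algebra.isMulCommutative_adjoin k ?_
    rintro _ ⟨i, rfl⟩ _ ⟨j, rfl⟩
    exact h i j
  let _ : CommRing (Algebra.adjoin k (Set.range θ)) :=
    { (inferInstance : Ring (Algebra.adjoin k (Set.range θ))) with
      mul_comm := fun a b => hcomm.is_comm.comm a b }
  refine ⟨(Algebra.adjoin k (Set.range θ)).val.comp
    (MvPolynomial.aeval fun i => ⟨θ i, Algebra.subset_adjoin ⟨i, rfl⟩⟩), fun i => ?_⟩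
  simp

/-- The Euler operator `x_j ∂_j`. -/
def euler (k : Type*) [Field k] {n : ℕ} (j : Fin n) : Weyl k n :=
  gen k (Sum.inl j) * gen k (Sum.inr j)

theorem euler_mul_x (k : Type*) [Field k] {n : ℕ} (i j : Fin n) :
    euler k i * gen k (Sum.inl j)
      = gen k (Sum.inl j) * (euler k i + if i = j then 1 else 0) := by
  unfold euler
  rw [mul_assoc, gen_dx, mul_add, ← mul_assoc, gen_xx k i j, mul_assoc, mul_add]
  split_ifs with h
  · rw [h]
  · simp

theorem euler_mul_d (k : Type*) [Field k] {n : ℕ} (i j : Fin n) :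
    euler k i * gen k (Sum.inr j)
      = gen k (Sum.inr j) * (euler k i - if i = j then 1 else 0) := by
  unfold euler
  rw [mul_sub, ← mul_assoc (gen k (Sum.inr j)), gen_dx, mul_assoc, gen_dd k i j, add_mul,
    mul_assoc]
  by_cases h : i = j
  · simp [h]
  · simp [h, Ne.symm h]

theorem commute_euler_x (k : Type*) [Field k] {n : ℕ} {i j : Fin n} (h : i ≠ j) :
    Commute (euler k i) (gen k (Sum.inl j)) := by
  have := euler_mul_x k i j
  rwa [if_neg h, add_zero] at this

theorem commute_euler_d (k : Type*) [Field k] {n : ℕ} {i j : Fin n} (h : i ≠ j) :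
    Commute (euler k i) (gen k (Sum.inr j)) := by
  have := euler_mul_d k i j
  rwa [if_neg h, sub_zero] at this

theorem commute_euler (k : Type*) [Field k] {n : ℕ} (i j : Fin n) :
    Commute (euler k i) (euler k j) := by
  by_cases h : i = j
  · rw [h]
  · exact (commute_euler_x k h).mul_right (commute_euler_d k h)

theorem euler_mul_x_pow (k : Type*) [Field k] {n : ℕ} (j : Fin n) (m : ℕ) :
    euler k j * gen k (Sum.inl j) ^ m = gen k (Sum.inl j) ^ m * (euler k j + m) := by
  induction m with
  | zero => simp
  | succ m ih =>
    rw [pow_succ, ← mul_assoc, ih, mul_assoc, add_mul, euler_mul_x, if_pos rfl,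
      ← (Nat.cast_commute m _).eq.symm, ← mul_add, ← mul_assoc, Nat.cast_succ, add_assoc,
      add_comm 1]

theorem euler_mul_d_pow (k : Type*) [Field k] {n : ℕ} (j : Fin n) (m : ℕ) :
    euler k j * gen k (Sum.inr j) ^ m = gen k (Sum.inr j) ^ m * (euler k j - m) := by
  induction m with
  | zero => simp
  | succ m ih =>
    rw [pow_succ, ← mul_assoc, ih, mul_assoc, sub_mul, euler_mul_d, if_pos rfl,
      ← (Nat.cast_commute m _).eq.symm, ← mul_sub, ← mul_assoc, Nat.cast_succ, sub_sub,
      add_comm 1]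

/-- The polynomial in the Euler operators which equals `∂_j ^ a x_j ^ a` if `a ≥ 0` and
`x_j ^ (-a) ∂_j ^ (-a)` if `a ≤ 0`. -/
noncomputable def eulerFactor (k : Type*) [Field k] {n : ℕ} (j : Fin n) (a : ℤ) :
    MvPolynomial (Fin n) k :=
  (∏ i ∈ Finset.range a.toNat, (MvPolynomial.X j + ((i + 1 : ℕ) : MvPolynomial (Fin n) k))) *
    ∏ i ∈ Finset.range (-a).toNat, (MvPolynomial.X j - (i : MvPolynomial (Fin n) k))

theorem d_pow_mul_x_pow {k : Type*} [Field k] {n : ℕ}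
    {ψ : MvPolynomial (Fin n) k →ₐ[k] Weyl k n} (hψ : ∀ j, ψ (MvPolynomial.X j) = euler k j)
    (j : Fin n) (m : ℕ) :
    gen k (Sum.inr j) ^ m * gen k (Sum.inl j) ^ m
      = ψ (∏ i ∈ Finset.range m, (MvPolynomial.X j + ((i + 1 : ℕ) : MvPolynomial (Fin n) k))) := by
  induction m with
  | zero => simp
  | succ m ih =>
    rw [Finset.prod_range_succ, map_mul, ← ih, map_add, hψ, map_natCast, mul_assoc, Nat.cast_succ,
      ← add_assoc, mul_add (gen k (Sum.inl j) ^ m), mul_one, ← euler_mul_x_pow, pow_succ, pow_succ',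
      mul_assoc, ← mul_assoc (gen k (Sum.inr j)) (gen k (Sum.inl j)), gen_dx, if_pos rfl, add_mul,
      one_mul]
    rfl

theorem x_pow_mul_d_pow {k : Type*} [Field k] {n : ℕ}
    {ψ : MvPolynomial (Fin n) k →ₐ[k] Weyl k n} (hψ : ∀ j, ψ (MvPolynomial.X j) = euler k j)
    (j : Fin n) (m : ℕ) :
    gen k (Sum.inl j) ^ m * gen k (Sum.inr j) ^ m
      = ψ (∏ i ∈ Finset.range m, (MvPolynomial.X j - (i : MvPolynomial (Fin n) k))) := by
  induction m with
  | zero => simp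
  | succ m ih =>
    rw [Finset.prod_range_succ, map_mul, ← ih, map_sub, hψ, map_natCast, mul_assoc,
      ← euler_mul_d_pow, pow_succ, pow_succ',
      mul_assoc, ← mul_assoc (gen k (Sum.inl j)) (gen k (Sum.inr j))]
    rfl

/-! ### Products of semi-invariant operators -/

theorem one_mem_weightSpace (k : Type*) [Field k] {n d : ℕ} (χ : Fin n → Fin d → ℤ) :
    (1 : Weyl k n) ∈ weightSpace k χ 0 :=
  ⟨fun t => by simp [chr_zero], fun θ => by simp [dchr_zero]⟩

theorem mul_mem_weightSpace {k : Type*} [Field k] {n d : ℕ} {χ : Fin n → Fin d → ℤ}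
    {a b : Fin d → ℤ} {P Q : Weyl k n} (hP : P ∈ weightSpace k χ a) (hQ : Q ∈ weightSpace k χ b) :
    P * Q ∈ weightSpace k χ (a + b) := by
  refine ⟨fun t => ?_, fun θ => ?_⟩
  · rw [map_mul, hP.1, hQ.1, smul_mul_smul_comm, chr_add, Units.val_mul]
  · rw [dchr_add, add_smul, ← smul_mul_assoc, ← hP.2 θ, ← mul_smul_comm (dchr b θ), ← hQ.2 θ]
    noncomm_ring

theorem pow_mem_weightSpace {k : Type*} [Field k] {n d : ℕ} {χ : Fin n → Fin d → ℤ}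
    {a : Fin d → ℤ} {P : Weyl k n} (hP : P ∈ weightSpace k χ a) (m : ℕ) :
    P ^ m ∈ weightSpace k χ ((m : ℤ) • a) := by
  induction m with
  | zero => simpa using one_mem_weightSpace k χ
  | succ m ih =>
    rw [pow_succ, Nat.cast_succ, add_smul, one_smul]
    exact mul_mem_weightSpace ih hP

theorem gen_mem_weightSpace (k : Type*) [Field k] {n d : ℕ} (χ : Fin n → Fin d → ℤ)
    (c : Fin n ⊕ Fin n) : gen k c ∈ weightSpace k χ (weight χ c) := by
  simpa using weightSpace_mul_gen χ (one_mem_weightSpace k χ) c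

theorem eulerHom_mem_weightSpace {k : Type*} [Field k] {n d : ℕ} (χ : Fin n → Fin d → ℤ)
    {ψ : MvPolynomial (Fin n) k →ₐ[k] Weyl k n} (hψ : ∀ j, ψ (MvPolynomial.X j) = euler k j)
    (g : MvPolynomial (Fin n) k) : ψ g ∈ weightSpace k χ 0 := by
  induction g using MvPolynomial.induction_on with
  | C a =>
    rw [← MvPolynomial.algebraMap_eq, AlgHom.commutes, Algebra.algebraMap_eq_smul_one]
    exact Submodule.smul_mem _ _ (one_mem_weightSpace k χ)
  | add p q hp hq =>
    rw [map_add]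
    exact add_mem hp hq
  | mul_X p j hp =>
    have hj : euler k j ∈ weightSpace k χ 0 := by
      have := mul_mem_weightSpace (gen_mem_weightSpace k χ (Sum.inl j))
        (gen_mem_weightSpace k χ (Sum.inr j))
      rwa [weight, Sum.elim_inl, Sum.elim_inr, add_neg_cancel] at this
    rw [map_mul, hψ]
    simpa using mul_mem_weightSpace hp hj

/-- `P` and `Q` are powers of `∂_j` and `x_j`, in the order given by the sign of `a`. The
commutation clause lets different indices be combined. -/
theorem exists_mul_eq_eulerFactor {k : Type*} [Field k] {n d : ℕ} (χ : Fin n → Fin d → ℤ)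
    {ψ : MvPolynomial (Fin n) k →ₐ[k] Weyl k n} (hψ : ∀ j, ψ (MvPolynomial.X j) = euler k j)
    (j : Fin n) (a : ℤ) :
    ∃ P ∈ weightSpace k χ (-(a • χ j)), ∃ Q ∈ weightSpace k χ (a • χ j),
      P * Q = ψ (eulerFactor k j a) ∧ ∀ i, i ≠ j → Commute (euler k i) Q := by
  have hx := fun m => pow_mem_weightSpace (gen_mem_weightSpace k χ (Sum.inl j)) m
  have hd := fun m => pow_mem_weightSpace (gen_mem_weightSpace k χ (Sum.inr j)) m
  simp only [weight, Sum.elim_inl, Sum.elim_inr, smul_neg] at hx hd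
  obtain ⟨m, rfl | rfl⟩ := a.eq_nat_or_neg
  · refine ⟨_, hd m, _, hx m, ?_, fun i hi => (commute_euler_x k hi).pow_right m⟩
    simp [eulerFactor, d_pow_mul_x_pow hψ]
  · simp only [neg_smul, neg_neg]
    refine ⟨_, hx m, _, hd m, ?_, fun i hi => (commute_euler_d k hi).pow_right m⟩
    simp [eulerFactor, x_pow_mul_d_pow hψ]

theorem commute_eulerHom {k : Type*} [Field k] {n : ℕ}
    {ψ : MvPolynomial (Fin n) k →ₐ[k] Weyl k n} (hψ : ∀ j, ψ (MvPolynomial.X j) = euler k j)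
    {Q : Weyl k n} {j : Fin n} (hQ : Commute (euler k j) Q) (a : ℤ) :
    Commute (ψ (eulerFactor k j a)) Q := by
  let C := (Subalgebra.centralizer k {Q}).comap ψ
  have hmem : ∀ {g}, g ∈ C ↔ Commute (ψ g) Q := fun {g} => by
    rw [Subalgebra.mem_comap, Subalgebra.mem_centralizer_iff]
    simp [Commute, SemiconjBy, eq_comm]
  have hX : MvPolynomial.X j ∈ C := hmem.mpr (by rwa [hψ])
  exact hmem.mp (mul_mem (prod_mem fun i _ => add_mem hX (natCast_mem C _))
    (prod_mem fun i _ => sub_mem hX (natCast_mem C _)))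

theorem exists_mul_eq_prod_eulerFactor {k : Type*} [Field k] {n d : ℕ} (χ : Fin n → Fin d → ℤ)
    {ψ : MvPolynomial (Fin n) k →ₐ[k] Weyl k n} (hψ : ∀ j, ψ (MvPolynomial.X j) = euler k j)
    (a : Fin n → ℤ) (s : Finset (Fin n)) :
    ∃ P ∈ weightSpace k χ (-∑ j ∈ s, a j • χ j), ∃ Q ∈ weightSpace k χ (∑ j ∈ s, a j • χ j),
      P * Q = ψ (∏ j ∈ s, eulerFactor k j (a j)) ∧ ∀ i ∉ s, Commute (euler k i) Q := by
  induction s using Finset.induction_on with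
  | empty =>
    exact ⟨1, by simpa using one_mem_weightSpace k χ, 1, by simpa using one_mem_weightSpace k χ,
      by simp, fun i _ => Commute.one_right _⟩
  | insert j s hj ih =>
    obtain ⟨P, hP, Q, hQ, hPQ, hcomm⟩ := ih
    obtain ⟨P', hP', Q', hQ', hPQ', hcomm'⟩ := exists_mul_eq_eulerFactor χ hψ j (a j)
    rw [Finset.sum_insert hj, Finset.prod_insert hj]
    refine ⟨P * P', ?_, Q' * Q, mul_mem_weightSpace hQ' hQ, ?_, fun i hi => ?_⟩
    · rw [neg_add_rev]
      exact mul_mem_weightSpace hP hP'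
    -- The inner product `P' * Q'` is a polynomial in the `j`-th Euler operator, which moves past
    -- `Q` because `Q` does not involve the index `j`.
    · rw [mul_assoc, ← mul_assoc P', hPQ', (commute_eulerHom hψ (hcomm j hj) _).eq, ← mul_assoc,
        hPQ, ← map_mul, mul_comm]
    · rw [Finset.mem_insert, not_or] at hi
      exact (hcomm' i hi.1).mul_right (hcomm i hi.2)

/-! ### The surjection relation -/

/-- The image of the multiplication map is stable under right multiplication by `U`: if `1` is a sum
of products `P * Q` modulo the ideal, then the class of an invariant `S` is the sum of the products
of `P` with `Q * S`. -/
theorem transferLE_of_one_mem {k : Type*} [Field k] [Infinite k] {n d : ℕ}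
    {χ : Fin n → Fin d → ℤ} {Λ δ : Fin d → ℤ}
    (h : (1 : Weyl k n) ∈ Submodule.span k
      {R | ∃ P ∈ weightSpace k χ (-δ), ∃ Q ∈ weightSpace k χ δ, R = P * Q} ⊔ rightIdeal k χ Λ) :
    TransferLE k χ Λ (Λ + δ) := by
  have hmem : ∀ {Λ a : Fin d → ℤ} {P : Weyl k n}, P ∈ weightSpace k χ a →
      cls χ Λ P ∈ semiInv k χ Λ a := by
    intro Λ a P hP t
    rw [actQuot_cls, hP.1, map_smul]
  intro u
  obtain ⟨S, hS, hSu⟩ := semiInv_lift χ u.2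
  obtain ⟨V, hV, W, hW, hVW⟩ := Submodule.mem_sup.mp h
  have hV' : ∀ V ∈ Submodule.span k
      {R | ∃ P ∈ weightSpace k χ (-δ), ∃ Q ∈ weightSpace k χ δ, R = P * Q},
      ∃ z, (transferMap k χ Λ (Λ + δ) z : DQuot k χ Λ) = cls χ Λ (V * S) := by
    intro V hV
    induction hV using Submodule.span_induction with
    | mem V hV =>
      obtain ⟨P, hP, Q, hQ, rfl⟩ := hV
      have hP' : cls χ Λ P ∈ B k χ Λ (Λ + δ) := hmem (by simpa using hP)
      have hQ' : cls χ (Λ + δ) (Q * S) ∈ B k χ (Λ + δ) Λ :=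
        hmem (by simpa using mul_mem_weightSpace hQ hS)
      refine ⟨Submodule.Quotient.mk (⟨_, hP'⟩ ⊗ₜ[k] ⟨_, hQ'⟩), ?_⟩
      rw [mul_assoc]
      exact mulB_coe χ Λ (Λ + δ) Λ ⟨_, hP'⟩ ⟨_, hQ'⟩ P (Q * S) rfl rfl
    | zero => exact ⟨0, by simp⟩
    | add V V' _ _ hV hV' =>
      obtain ⟨z, hz⟩ := hV
      obtain ⟨z', hz'⟩ := hV'
      exact ⟨z + z', by rw [map_add, Submodule.coe_add, hz, hz', add_mul, map_add]⟩
    | smul r V _ hV =>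
      obtain ⟨z, hz⟩ := hV
      exact ⟨r • z, by rw [map_smul, Submodule.coe_smul, hz, smul_mul_assoc, map_smul]⟩
  obtain ⟨z, hz⟩ := hV' V hV
  refine ⟨z, Subtype.ext ?_⟩
  rw [hz, ← hSu]
  conv_rhs => rw [← one_mul S, ← hVW, add_mul, map_add,
    (cls_eq_zero χ Λ).mpr (rightIdeal_mul_mem χ hW S), add_zero]

/-- Nullstellensatz criterion for the surjection relation. -/
theorem transferLE_of_forall_exists {k : Type*} [Field k] [IsAlgClosed k] {n d : ℕ}
    {χ : Fin n → Fin d → ℤ} {Λ δ : Fin d → ℤ}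
    (h : ∀ z : Fin n → k, (∀ i, ∑ j, (χ j i : k) * z j = (Λ i : k)) →
      ∃ a : Fin n → ℤ, ∑ j, a j • χ j = δ ∧
        ∀ j, MvPolynomial.eval z (eulerFactor k j (a j)) ≠ 0) :
    TransferLE k χ Λ (Λ + δ) := by
  have : Infinite k := IsAlgClosed.instInfinite
  obtain ⟨ψ, hψ⟩ := exists_algHom_of_commute (k := k) (euler k (n := n)) (commute_euler k)
  set V := Submodule.span k
    {R | ∃ P ∈ weightSpace k χ (-δ), ∃ Q ∈ weightSpace k χ δ, R = P * Q} with hVdef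
  have hmulV : ∀ (T : Weyl k n), T ∈ weightSpace k χ 0 → ∀ v ∈ V, T * v ∈ V := by
    intro T hT v hv
    have hle : V ≤ V.comap (LinearMap.mulLeft k T) := by
      refine Submodule.span_le.mpr ?_
      rintro _ ⟨P, hP, Q, hQ, rfl⟩
      refine Submodule.subset_span ⟨T * P, ?_, Q, hQ, by simp [mul_assoc]⟩
      simpa using mul_mem_weightSpace hT hP
    exact hle hv
  -- Although `rightIdeal` is only a right ideal, operators of weight `0` preserve it under left
  -- multiplication, so `J` is an ideal.
  let J : Ideal (MvPolynomial (Fin n) k) :=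
    { carrier := {g | ψ g ∈ V ⊔ rightIdeal k χ Λ}
      zero_mem' := by simp
      add_mem' := by
        intro f g hf hg
        rw [Set.mem_ofPred_eq, map_add]
        exact add_mem hf hg
      smul_mem' := by
        intro f g hg
        have hf := eulerHom_mem_weightSpace χ hψ f
        obtain ⟨v, hv, w, hw, hvw⟩ := Submodule.mem_sup.mp hg
        rw [Set.mem_ofPred_eq, smul_eq_mul, map_mul, ← hvw, mul_add]
        exact Submodule.add_mem_sup (hmulV _ hf v hv)
          (mul_mem_rightIdeal χ (by simpa using hf) hw) }
  have hfactor : ∀ a : Fin n → ℤ, ∑ j, a j • χ j = δ → ∏ j, eulerFactor k j (a j) ∈ J := by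
    intro a ha
    obtain ⟨P, hP, Q, hQ, hPQ, -⟩ := exists_mul_eq_prod_eulerFactor χ hψ a Finset.univ
    rw [ha] at hP hQ
    exact Submodule.mem_sup_left (Submodule.subset_span ⟨P, hP, Q, hQ, hPQ.symm⟩)
  have hlin : ∀ i, ∑ j, MvPolynomial.C (χ j i : k) * MvPolynomial.X j
      - MvPolynomial.C (Λ i : k) ∈ J := by
    intro i
    refine Submodule.mem_sup_right (Submodule.subset_span ⟨Pi.single i 1, 1, ?_⟩)
    have hdchr : ∀ a : Fin d → ℤ, dchr a (Pi.single i 1 : Fin d → k) = a i := by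
      intro a
      simp [dchr, Pi.single_apply]
    rw [mul_one, comoment, map_sub, map_sum]
    simp only [map_mul, hψ, hdchr, ← MvPolynomial.algebraMap_eq, AlgHom.commutes, Algebra.smul_def,
      euler]
  have htop : J = ⊤ := by
    -- A common zero would satisfy the moment map equations `hlin`, so the hypothesis supplies an
    -- element of `J` that is nonzero there.
    have hzero : MvPolynomial.zeroLocus k J = ∅ := by
      refine Set.eq_empty_iff_forall_notMem.mpr fun z hz => ?_
      rw [MvPolynomial.mem_zeroLocus_iff] at hz
      simp only [← MvPolynomial.coe_aeval_eq_eval] at h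
      obtain ⟨a, ha, hne⟩ := h z fun i => by
        simpa [sub_eq_zero] using hz _ (hlin i)
      have := hz _ (hfactor a ha)
      rw [map_prod] at this
      exact Finset.prod_ne_zero_iff.mpr (fun j _ => hne j) this
    have hrad := MvPolynomial.vanishingIdeal_zeroLocus_eq_radical (K := k) J
    rw [hzero, MvPolynomial.vanishingIdeal_empty] at hrad
    exact Ideal.radical_eq_top.mp hrad.symm
  have h1 : (1 : MvPolynomial (Fin n) k) ∈ J := htop ▸ Submodule.mem_top
  refine transferLE_of_one_mem ?_
  have h2 : ψ 1 ∈ V ⊔ rightIdeal k χ Λ := h1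
  rwa [map_one] at h2

/-- The roots are `-1, …, -a` if `a > 0` and `0, …, -a - 1` if `a < 0`. The half-open interval `[-M,
M)` holds both lists, and its `2M` elements give the factor `2N` in the bound on `p`. -/
theorem eval_eulerFactor_ne_zero {k : Type*} [Field k] {n : ℕ} {z : Fin n → k} {M : ℕ}
    {j : Fin n} {a : ℤ} (ha : |a| ≤ M) (hz : a ≠ 0 → ∀ i ∈ Finset.Ico (-M : ℤ) M, z j ≠ (i : k)) :
    MvPolynomial.eval z (eulerFactor k j a) ≠ 0 := by
  rw [abs_le] at ha
  simp only [eulerFactor, map_mul, map_prod, map_add, map_sub, MvPolynomial.eval_X, map_natCast]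
  refine mul_ne_zero (Finset.prod_ne_zero_iff.mpr fun i hi h0 => ?_)
    (Finset.prod_ne_zero_iff.mpr fun i hi h0 => ?_)
  · rw [Finset.mem_range] at hi
    refine hz (by omega) (-(i + 1)) (by rw [Finset.mem_Ico]; omega) ?_
    push_cast at h0 ⊢
    linear_combination h0
  · rw [Finset.mem_range] at hi
    refine hz (by omega) i (by rw [Finset.mem_Ico]; omega) ?_
    push_cast
    linear_combination h0

/-! ### Counting parameters over the prime field -/

theorem card_filter_dotProduct_mem_le {F k : Type*} [Field F] [Fintype F] [Field k]
    [DecidableEq k] (f : F →+* k) {d : ℕ} {b : Fin d → k} (hb : b ≠ 0) (V : Finset k) :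
    (Finset.univ.filter fun x : Fin d → F => (f ∘ x) ⬝ᵥ b ∈ V).card
      ≤ V.card * Fintype.card F ^ (d - 1) := by
  classical
  obtain ⟨i₀, hi₀⟩ := Function.ne_iff.mp hb
  have hcard : (V ×ˢ (Finset.univ : Finset ({i // i ≠ i₀} → F))).card
      = V.card * Fintype.card F ^ (d - 1) := by
    simp [Finset.card_product]
  rw [← hcard]
  -- A solution is determined by the value of the functional and the coordinates other than `i₀`,
  -- since `b i₀ ≠ 0` and `f` is injective.
  refine Finset.card_le_card_of_injOn (fun x => ((f ∘ x) ⬝ᵥ b, fun i => x i)) ?_ ?_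
  · intro x hx
    simpa using hx
  · intro x _ y _ hxy
    obtain ⟨h1, h2⟩ := Prod.ext_iff.mp hxy
    have h3 : ∀ i, i ≠ i₀ → x i = y i := fun i hi => congrFun h2 ⟨i, hi⟩
    have h4 : f (x i₀) = f (y i₀) := by
      simp only [dotProduct] at h1
      rw [← Finset.add_sum_erase _ _ (Finset.mem_univ i₀),
        ← Finset.add_sum_erase Finset.univ (fun i => (f ∘ y) i * b i) (Finset.mem_univ i₀),
        Finset.sum_congr rfl fun i hi => by
          rw [Function.comp_apply, h3 i (Finset.ne_of_mem_erase hi)]] at h1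
      exact mul_right_cancel₀ hi₀ (add_right_cancel h1)
    ext i
    by_cases hi : i = i₀
    · rw [hi]
      exact f.injective h4
    · exact h3 i hi

/-- The residues of the integers in `[-M, M)`. -/
noncomputable def smallResidues (k : Type*) [Field k] [DecidableEq k] (M : ℕ) : Finset k :=
  (Finset.Ico (-M : ℤ) M).image Int.cast

theorem card_smallResidues_le (k : Type*) [Field k] [DecidableEq k] (M : ℕ) :
    (smallResidues k M).card ≤ 2 * M := by
  refine Finset.card_image_le.trans ?_
  rw [Int.card_Ico]
  omega

/-- The values `∑_j c_j s_j` with `c_j` a small residue if `j ∉ I` and `c_j = 0` if `j ∈ I`. -/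
noncomputable def smallCombinations {k : Type*} [Field k] [DecidableEq k] {n : ℕ} (M : ℕ)
    (I : Finset (Fin n)) (s : Fin n → k) : Finset k :=
  (Fintype.piFinset fun j => if j ∈ I then {0} else smallResidues k M).image fun c => c ⬝ᵥ s

theorem card_smallCombinations_le {k : Type*} [Field k] [DecidableEq k] {n : ℕ} (M : ℕ)
    (I : Finset (Fin n)) (s : Fin n → k) :
    (smallCombinations M I s).card ≤ (2 * M) ^ (n - I.card) := by
  refine Finset.card_image_le.trans ?_
  rw [Fintype.card_piFinset]
  have : ∀ j, (if j ∈ I then ({0} : Finset k) else smallResidues k M).card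
      ≤ if j ∈ I then 1 else 2 * M := by
    intro j
    split_ifs
    · simp
    · exact card_smallResidues_le k M
  refine (Finset.prod_le_prod' fun j _ => this j).trans (le_of_eq ?_)
  rw [Finset.prod_ite, Finset.prod_const_one, one_mul, Finset.prod_const]
  congr 1
  rw [Finset.filter_not, Finset.filter_mem_eq_inter, Finset.univ_inter,
    ← Finset.compl_eq_univ_sdiff, Finset.card_compl, Fintype.card_fin]

/-- A character avoiding, for every set `I` of `d - 1` weights, the small values of a functional
killing these weights. -/
theorem exists_character_notMem_smallCombinations (k : Type*) [Field k] [DecidableEq k] (p : ℕ)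
    [Fact p.Prime] [CharP k p] {n d : ℕ} (hd : 0 < d) (hdn : d < n) (χ : Fin n → Fin d → ℤ)
    {M : ℕ} (hM : n.choose (d - 1) * (2 * M) ^ (n - d + 1) < p)
    (b : Finset (Fin n) → Fin d → k) (hb : ∀ I, I.card = d - 1 → b I ≠ 0) :
    ∃ Λ : Fin d → ℤ, ∀ I : Finset (Fin n), I.card = d - 1 →
      (fun i => (Λ i : k)) ⬝ᵥ b I
        ∉ smallCombinations M I fun j => castWeight k χ j ⬝ᵥ b I := by
  classical
  let f : ZMod p →+* k := ZMod.castHom dvd_rfl k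
  let bad : Finset (Fin n) → Finset (Fin d → ZMod p) := fun I =>
    Finset.univ.filter fun x => (f ∘ x) ⬝ᵥ b I
      ∈ smallCombinations M I fun j => castWeight k χ j ⬝ᵥ b I
  -- Union bound over the sets `I` of size `d - 1`; the exponent `n - d + 1` is the number of
  -- indices outside `I`.
  have hcard : ((Finset.univ.powersetCard (d - 1)).biUnion bad).card
      < (Finset.univ : Finset (Fin d → ZMod p)).card := by
    calc _ ≤ ∑ I ∈ Finset.univ.powersetCard (d - 1), (bad I).card := Finset.card_biUnion_le
      _ ≤ ∑ I ∈ (Finset.univ : Finset (Fin n)).powersetCard (d - 1),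
            (2 * M) ^ (n - d + 1) * p ^ (d - 1) := by
          refine Finset.sum_le_sum fun I hI => ?_
          have hI' := (Finset.mem_powersetCard.mp hI).2
          refine (card_filter_dotProduct_mem_le f (hb I hI') _).trans ?_
          rw [ZMod.card]
          refine Nat.mul_le_mul_right _ ((card_smallCombinations_le M I _).trans (le_of_eq ?_))
          congr 1
          omega
      _ = n.choose (d - 1) * (2 * M) ^ (n - d + 1) * p ^ (d - 1) := by
          rw [Finset.sum_const, Finset.card_powersetCard, Finset.card_univ, Fintype.card_fin,
            smul_eq_mul, mul_assoc]
      _ < p * p ^ (d - 1) :=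
          Nat.mul_lt_mul_of_pos_right hM (pow_pos (Fact.out : p.Prime).pos _)
      _ = _ := by
          rw [← pow_succ', Nat.sub_add_cancel hd, Finset.card_univ, Fintype.card_fun, ZMod.card,
            Fintype.card_fin]
  obtain ⟨x, -, hx⟩ := Finset.exists_mem_notMem_of_card_lt_card hcard
  -- Any integral lift will do: only the residues of `Λ` modulo `p` enter.
  refine ⟨fun i => ((x i).val : ℤ), fun I hI hmem => hx ?_⟩
  refine Finset.mem_biUnion.mpr ⟨I, Finset.mem_powersetCard.mpr ⟨Finset.subset_univ _, hI⟩, ?_⟩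
  refine Finset.mem_filter.mpr ⟨Finset.mem_univ _, ?_⟩
  convert hmem using 2
  ext i
  simp [f, ZMod.castHom_apply]

theorem exists_transferLE (k : Type*) [Field k] [IsAlgClosed k] (p : ℕ) [Fact p.Prime] [CharP k p]
    {n d : ℕ} (hd : 0 < d) (hdn : d < n) {χ : Fin n → Fin d → ℤ}
    (hspan : Submodule.span ℤ (Set.range χ) = ⊤) (hχ : IsUnimodular χ) (δ : Fin d → ℤ)
    (hp : (n.choose (d - 1) : ℝ) * (2 * vertexBound χ δ) ^ (n - d + 1) < p) :
    ∃ Λ : Fin d → ℤ, TransferLE k χ Λ (Λ + δ) := by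
  classical
  -- The coordinates of `δ` are integers, so the bound may be rounded down.
  set M := ⌊vertexBound χ δ⌋₊
  have hM : n.choose (d - 1) * (2 * M) ^ (n - d + 1) < p := by
    have h : (M : ℝ) ≤ vertexBound χ δ := Nat.floor_le (vertexBound_nonneg χ δ)
    have : (n.choose (d - 1) : ℝ) * (2 * M) ^ (n - d + 1) < p := lt_of_le_of_lt (by gcongr) hp
    exact_mod_cast this
  -- The functionals are fixed for all `I` at once, because `Λ` must be chosen before `z`.
  have hb : ∀ I : Finset (Fin n), ∃ b : Fin d → k, I.card = d - 1 →
      b ≠ 0 ∧ ∀ j ∈ I, castWeight k χ j ⬝ᵥ b = 0 := by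
    intro I
    by_cases hI : I.card < d
    · obtain ⟨b, hb⟩ := exists_ne_zero_forall_dotProduct_eq_zero (castWeight k χ) hI
      exact ⟨b, fun _ => hb⟩
    · exact ⟨0, fun h => by omega⟩
  choose b hb using hb
  obtain ⟨Λ, hΛ⟩ := exists_character_notMem_smallCombinations k p hd hdn χ hM b
    fun I hI => (hb I hI).1
  refine ⟨Λ, transferLE_of_forall_exists fun z hz => ?_⟩
  rcases exists_basis_or_subset_hyperplane (span_castWeight k hspan)
    {j | z j ∉ smallResidues k M} with ⟨e, heS, he⟩ | ⟨e, i₀, he, hS⟩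
  · obtain ⟨a, ha0, ha, hbound⟩ :=
      exists_bounded_coordinates hχ (det_ne_zero_of_linearIndependent he) δ
    refine ⟨a, ha, fun j => eval_eulerFactor_ne_zero (M := M) ?_ fun hne i hi hzi => ?_⟩
    · rw [Int.abs_eq_natAbs, Nat.cast_le]
      refine Nat.le_floor ?_
      rw [Nat.cast_natAbs, Int.cast_abs]
      exact hbound j
    · have hj : j ∈ Set.range e := by
        by_contra hj
        exact hne (ha0 j hj)
      obtain ⟨i', rfl⟩ := hj
      exact heS i' (Finset.mem_image.mpr ⟨i, hi, hzi.symm⟩)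
  -- The weights with `z j` not small lie in a hyperplane. Pairing the moment map equation with `b
  -- I` shows that `Λ` is one of the excluded characters.
  exfalso
  have hinj := injective_of_det_ne_zero (det_ne_zero_of_linearIndependent he)
  set I := (Finset.univ.erase i₀).image e with hI
  have hIcard : I.card = d - 1 := by
    rw [hI, Finset.card_image_of_injective _ hinj, Finset.card_erase_of_mem (Finset.mem_univ _),
      Finset.card_univ, Fintype.card_fin]
  obtain ⟨-, hbI⟩ := hb I hIcard
  have hperp : ∀ j, z j ∉ smallResidues k M → castWeight k χ j ⬝ᵥ b I = 0 := by
    intro j hj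
    have hmem := hS j hj
    generalize castWeight k χ j = v at hmem
    induction hmem using Submodule.span_induction with
    | mem v hv =>
      obtain ⟨i, hi, rfl⟩ := hv
      exact hbI (e i) (Finset.mem_image_of_mem e (Finset.mem_erase.mpr ⟨hi, Finset.mem_univ _⟩))
    | zero => exact zero_dotProduct _
    | add v w _ _ hv hw => rw [add_dotProduct, hv, hw, add_zero]
    | smul r v _ hv => rw [smul_dotProduct, hv, smul_zero]
  -- The basis weight outside the hyperplane has a small coordinate. It serves as a filler where `z
  -- j` is not small: the pairing with `b I` vanishes there, so the coefficient is arbitrary but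
  -- must still be a small residue.
  have hfill : z (e i₀) ∈ smallResidues k M := by
    by_contra h
    exact he.notMem_span_image (s := {i₀}ᶜ) (x := i₀) (by simp) (hS _ h)
  refine hΛ I hIcard (Finset.mem_image.mpr ⟨fun j => if j ∈ I then 0 else
    if z j ∈ smallResidues k M then z j else z (e i₀), ?_, ?_⟩)
  · rw [Fintype.mem_piFinset]
    intro j
    split_ifs with h1 h2
    · simp
    · exact h2
    · exact hfill
  · have h1 : (fun i => (Λ i : k)) ⬝ᵥ b I = ∑ j, z j * (castWeight k χ j ⬝ᵥ b I) := by
      simp only [dotProduct, castWeight, ← hz, Finset.sum_mul, Finset.mul_sum]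
      rw [Finset.sum_comm]
      exact Finset.sum_congr rfl fun j _ => Finset.sum_congr rfl fun i _ => by ring
    rw [h1]
    refine Finset.sum_congr rfl fun j _ => ?_
    dsimp only
    split_ifs with h2 h3
    · rw [hbI j h2, mul_zero, mul_zero]
    · rfl
    · rw [hperp j h3, mul_zero, mul_zero]

end Hypertoric

/-! ### Conclusion: from the bound for `N` to a single generic character. -/

theorem mainTheorem5 (k : Type*) [Field k] [IsAlgClosed k]
    (p : ℕ) [Fact p.Prime] [CharP k p]
    (n d : ℕ) (hd : 0 < d) (hdn : d < n)
    (χ : Fin n → Fin d → ℤ)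
    (hspan : Submodule.span ℤ (Set.range χ) = ⊤)
    (hunimod : Hypertoric.IsUnimodular χ)
    (hp : (n.choose (d - 1) : ℝ) * (2 * Hypertoric.minBound χ) ^ (n - d + 1) < (p : ℝ)) :
    ∃ δ Λ : Fin d → ℤ,
      Hypertoric.IsSmoothParameter k χ δ ∧ Hypertoric.TransferLE k χ Λ (Λ + δ) := by
  have : Infinite k := IsAlgClosed.instInfinite
  have hcont : Continuous fun x : ℝ => (n.choose (d - 1) : ℝ) * (2 * x) ^ (n - d + 1) := by
    fun_prop
  -- The strict inequality for `N` is an open condition, so it persists for some generic `δ` with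
  -- `N(δ)` close to `N`.
  obtain ⟨δ, hδ, hlt⟩ := Hypertoric.exists_isGeneric_vertexBound_mem hd χ
    (isOpen_lt hcont continuous_const) hp
  obtain ⟨Λ, hΛ⟩ := Hypertoric.exists_transferLE k p hd hdn hspan hunimod δ hlt
  exact ⟨δ, Λ, Hypertoric.isSmoothParameter_of_isGeneric k hspan hunimod hδ, hΛ⟩
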